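/- Let $r\ge 0$ be a fixed integer. For a finite set $C$ of candidates, a vote is a linear ordering $\succ$ of $C$; it gives one point to each candidate in its top $r$ positions and none to the others. A winner is a candidate of highest total score, and a unique winner is an only winner. Let $L$ be a linear ordering of $C$. A vote is single-peaked with respect to (a consecutive piece of) $L$ if for all candidates $a,b,c$ (of this piece) such that $b$ lies between $a$ and $c$ in $L$, $c\succ b$ implies $b\succ a$. A vote is $2$-peaked with respect to $L$ if $L$ can be cut into two consecutive pieces such that the vote, restricted to the candidates of either piece, is single-peaked with respect to that piece. The problem $r$-AV-$2$ ($r$-sincere-strategy preference-based approval control by adding votes in $2$-peaked elections) is the following. Input: a finite set $C$ of candidates with a distinguished candidate $p\in C$, a linear ordering $L$ of $C$, a finite multiset $V$ of registered votes and a finite multiset $T$ of unregistered votes, all of them $2$-peaked with respect to $L$, and an integer $0\le R\le |T|$. Question: is there a submultiset $T'$ of $T$ with $|T'|\le R$ such that $p$ is the unique winner of the election with candidates $C$ and votes $V\uplus T'$? Theorem. For every constant $r$, the problem $r$-AV-$2$ is solvable in polynomial time: there are a program for a deterministic random access machine (with addition and truncated subtraction as its only arithmetic operations, each elementary operation costing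 one time unit) and a polynomial $q$, both depending only on $r$, such that on every instance, with all votes and the ordering $L$ written out explicitly as lists of candidates and with $n$ the length of the input in bits, the program halts within $q(n)$ time units and answers correctly. -/

import Mathlib

/-! ### Rankings, approval scores, winners -/

/-- A linear ordering of the `m` candidates `Fin m`, given by the bijection that sends each
position (`0` is the first one) to the candidate standing there.  Votes and the ordering of the
candidates along the axis are both of this kind. -/
abbrev Ranking (m : ℕ) : Type := Equiv.Perm (Fin m)

namespace Ranking

/-- `a` is placed before `b`: for a vote this is `a ≻ b`, for the axis `L` this is `a L b`. -/
def Before {m : ℕ} (π : Ranking m) (a b : Fin m) : Prop := π.symm a < π.symm b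

/-- The vote `π`, restricted to the set `S` of candidates, is single-peaked with respect to the
axis `L` restricted to `S`. -/
def SinglePeakedOn {m : ℕ} (L π : Ranking m) (S : Set (Fin m)) : Prop :=
  ∀ a ∈ S, ∀ b ∈ S, ∀ c ∈ S,
    ((L.Before a b ∧ L.Before b c) ∨ (L.Before c b ∧ L.Before b a)) →
      π.Before c b → π.Before b a

/-- The vote `π` is `k`-peaked with respect to the axis `L`: the axis can be cut into `k`
consecutive blocks (the block of each position is given by the monotone map `block`; blocks may be
empty) such that `π` is single-peaked on each of them. -/
def KPeaked {m : ℕ} (k : ℕ) (L π : Ranking m) : Prop :=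
  ∃ block : Fin m → Fin k, Monotone block ∧
    ∀ i : Fin k, SinglePeakedOn L π {c | block (L.symm c) = i}

/-- The sequence of candidates, from the first position to the last one. -/
def toList {m : ℕ} (π : Ranking m) : List ℕ := List.ofFn fun i => (π i : ℕ)

end Ranking

/-- The score of `c` when each vote gives one point to each candidate in its top `r` positions. -/
def score {m : ℕ} (r : ℕ) (Γ : Multiset (Ranking m)) (c : Fin m) : ℕ :=
  Γ.countP fun π => (π.symm c : ℕ) < r

/-- `c` has the highest score. -/
def IsWinner {m : ℕ} (r : ℕ) (Γ : Multiset (Ranking m)) (c : Fin m) : Prop :=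
  ∀ d : Fin m, score r Γ d ≤ score r Γ c

/-- `c` is the only winner. -/
def IsUniqueWinner {m : ℕ} (r : ℕ) (Γ : Multiset (Ranking m)) (c : Fin m) : Prop :=
  IsWinner r Γ c ∧ ∀ d : Fin m, IsWinner r Γ d → d = c

/-! ### The control problem -/

/-- An instance of control by adding votes in `k`-peaked elections, with the `k`-harmonious
ordering `L` given. -/
structure AVInstance (k : ℕ) where
  /-- the number of candidates, the distinguished one included -/
  m : ℕ
  /-- the distinguished candidate -/
  p : Fin m
  /-- the given ordering of the candidates -/
  L : Ranking m
  /-- the registered votes -/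
  V : List (Ranking m)
  /-- the unregistered votes -/
  T : List (Ranking m)
  /-- the number of votes that may be added -/
  R : ℕ
  peaked_V : ∀ π ∈ V, Ranking.KPeaked k L π
  peaked_T : ∀ π ∈ T, Ranking.KPeaked k L π
  R_le : R ≤ T.length

namespace AVInstance

/-- Can one add at most `R` of the unregistered votes so that `p` becomes the unique winner, when
each vote approves its top `r` candidates? -/
def IsYes {k : ℕ} (r : ℕ) (I : AVInstance k) : Prop :=
  ∃ T' : Multiset (Ranking I.m), T' ≤ (I.T : Multiset (Ranking I.m)) ∧
    Multiset.card T' ≤ I.R ∧ IsUniqueWinner r ((I.V : Multiset (Ranking I.m)) + T') I.p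

/-- The instance written down as a sequence of natural numbers: the number of candidates, the
distinguished candidate, the bound on the number of added votes, the numbers of registered and of
unregistered votes; then `L`, the registered votes and the unregistered votes, each as the sequence
of its `m` candidates. -/
def encode {k : ℕ} (I : AVInstance k) : List ℕ :=
  [I.m, (I.p : ℕ), I.R, I.V.length, I.T.length] ++
    (I.L.toList ++ (I.V.flatMap Ranking.toList ++ I.T.flatMap Ranking.toList))

end AVInstance

/-! ### Random access machines and polynomial time

A deterministic random access machine with a read-only input (a finite sequence of natural
numbers) and a memory of natural-number cells with indirect addressing.  Each elementary operation
costs one time unit; the only arithmetic operations are addition and truncated subtraction, so the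
bit length of every number that occurs is at most linear in the length of the input plus the time
used, and polynomial time is the same as on Turing machines. -/

namespace RAM

/-- The contents of the memory cells. -/
abbrev Memory : Type := ℕ → ℕ

inductive Expr : Type
  /-- a constant -/
  | const (n : ℕ) : Expr
  /-- the number at a given place of the input, `0` beyond its end -/
  | read (e : Expr) : Expr
  /-- the contents of the memory cell with a given address -/
  | load (e : Expr) : Expr
  | add (e f : Expr) : Expr
  /-- truncated subtraction -/
  | sub (e f : Expr) : Expr

/-- The value of an expression on the input `x` with memory `μ`. -/
def Expr.eval (x : List ℕ) (μ : Memory) : Expr → ℕ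
  | .const n => n
  | .read e => x.getD (e.eval x μ) 0
  | .load e => μ (e.eval x μ)
  | .add e f => e.eval x μ + f.eval x μ
  | .sub e f => e.eval x μ - f.eval x μ

/-- The number of elementary operations in an expression. -/
def Expr.cost : Expr → ℕ
  | .const _ => 1
  | .read e => e.cost + 1
  | .load e => e.cost + 1
  | .add e f => e.cost + f.cost + 1
  | .sub e f => e.cost + f.cost + 1

inductive Program : Type
  | skip : Program
  /-- write the value of the second expression to the cell whose address is the value of the first -/
  | store (a e : Expr) : Program
  | seq (P Q : Program) : Program
  /-- run `P` if the value of `e` is not `0`, otherwise `Q` -/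
  | cond (e : Expr) (P Q : Program) : Program
  /-- as long as the value of `e` is not `0`, run `P` -/
  | loop (e : Expr) (P : Program) : Program

/-- `Exec x P μ t ν`: on the input `x` and started with memory `μ`, the program `P` halts after
exactly `t` time units with memory `ν`. -/
inductive Exec (x : List ℕ) : Program → Memory → ℕ → Memory → Prop
  | skip (μ : Memory) : Exec x .skip μ 1 μ
  | store (a e : Expr) (μ : Memory) :
      Exec x (.store a e) μ (a.cost + e.cost + 1)
        (Function.update μ (a.eval x μ) (e.eval x μ))
  | seq {P Q : Program} {μ ν ξ : Memory} {s t : ℕ} :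
      Exec x P μ s ν → Exec x Q ν t ξ → Exec x (.seq P Q) μ (s + t) ξ
  | cond_true {e : Expr} {P Q : Program} {μ ν : Memory} {t : ℕ} :
      e.eval x μ ≠ 0 → Exec x P μ t ν → Exec x (.cond e P Q) μ (e.cost + 1 + t) ν
  | cond_false {e : Expr} {P Q : Program} {μ ν : Memory} {t : ℕ} :
      e.eval x μ = 0 → Exec x Q μ t ν → Exec x (.cond e P Q) μ (e.cost + 1 + t) ν
  | loop_stop {e : Expr} {P : Program} {μ : Memory} :
      e.eval x μ = 0 → Exec x (.loop e P) μ (e.cost + 1) μ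
  | loop_step {e : Expr} {P : Program} {μ ν ξ : Memory} {s t : ℕ} :
      e.eval x μ ≠ 0 → Exec x P μ s ν → Exec x (.loop e P) ν t ξ →
        Exec x (.loop e P) μ (e.cost + 1 + s + t) ξ

/-- The machine is deterministic: running time and final memory are determined. -/
theorem Exec.deterministic {x : List ℕ} {P : Program} {μ ν ν' : Memory} {t t' : ℕ}
    (h : Exec x P μ t ν) (h' : Exec x P μ t' ν') : t = t' ∧ ν = ν' := by
  induction h generalizing t' ν' with
  | skip μ => cases h'; exact ⟨rfl, rfl⟩
  | store a e μ => cases h'; exact ⟨rfl, rfl⟩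
  | seq _ _ ih₁ ih₂ =>
    cases h' with
    | seq g₁ g₂ =>
      obtain ⟨rfl, rfl⟩ := ih₁ g₁
      obtain ⟨rfl, rfl⟩ := ih₂ g₂
      exact ⟨rfl, rfl⟩
  | cond_true he _ ih =>
    cases h' with
    | cond_true _ g => obtain ⟨rfl, rfl⟩ := ih g; exact ⟨rfl, rfl⟩
    | cond_false he' _ => exact absurd he' he
  | cond_false he _ ih =>
    cases h' with
    | cond_true he' _ => exact absurd he he'
    | cond_false _ g => obtain ⟨rfl, rfl⟩ := ih g; exact ⟨rfl, rfl⟩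
  | loop_stop he =>
    cases h' with
    | loop_stop _ => exact ⟨rfl, rfl⟩
    | loop_step he' _ _ => exact absurd he he'
  | loop_step he _ _ ih₁ ih₂ =>
    cases h' with
    | loop_stop he' => exact absurd he' he
    | loop_step _ g₁ g₂ =>
      obtain ⟨rfl, rfl⟩ := ih₁ g₁
      obtain ⟨rfl, rfl⟩ := ih₂ g₂
      exact ⟨rfl, rfl⟩

/-- The length of an input in bits, with one separator for each number. -/
def inputLength (x : List ℕ) : ℕ := (x.map fun n => n.size + 1).sum

/-- The decision problem with instances `α`, written down by `encode`, and with the question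
`Yes`, is solvable in polynomial time: one program halts on every instance, within a number of time
units that is polynomial in the length of the input, and its answer (cell `0` is nonzero at the
end) is yes exactly for the yes-instances. All cells hold `0` at the start. -/
def PolyTimeSolvable {α : Type} (encode : α → List ℕ) (Yes : α → Prop) : Prop :=
  ∃ (P : Program) (q : Polynomial ℕ), ∀ I : α, ∃ (t : ℕ) (ν : Memory),
    Exec (encode I) P (fun _ => 0) t ν ∧ t ≤ q.eval (inputLength (encode I)) ∧
      (ν 0 ≠ 0 ↔ Yes I)

end RAM

/-! Dropping the added votes that do not approve `p` keeps the score of `p` and raises no other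
score, so only votes approving `p` matter (`AVInstance.isYes_iff`). Fix the number `l` of votes
added. The final score of `p` is then known, and every other candidate has a fixed capacity for
further points.

Inside one block of the axis the approved candidates of a vote are consecutive, hence fewer than `r`
places apart. If the vote approves `p`, those in the block of `p` are near `p`; since there is only
one other block, all approved candidates at distance more than `r` from `p` lie within `r`
consecutive places (`Ranking.KPeaked.lt_add_of_far`). So the axis can be swept from its last place
to its first, each vote being taken or left at its last far place. It suffices to remember the loads
on the `r` places of the current window and on the at most `2 * r + 1` places near `p`. A place
leaving the window receives no further load and is checked then; the places near `p` are checked at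
the end. Every load is at most `|T|`, so both vectors are numbers written in base `|T| + 1`, and for
constant `r` the number of states is polynomial. `SelectionData.Located.feas_iff` proves this sweep
correct for abstract items, and `AVInstance.located` shows that the votes are such items.

For the machine, the recursion is written in a small language of terms with bounded sums. Every term
compiles to a program whose time and value are polynomially bounded (`Term.exists_poly`). A table of
truth values, indexed by coded states and filled in increasing order, then decides the problem
(`polyTimeSolvable_of_terms`). -/

namespace RAM

/-! ### Running programs within a time bound -/

/-- A counting loop with an invariant. -/
theorem exists_exec_loop {x : List ℕ} {e : Expr} {P : Program} (Inv : ℕ → Memory → Prop)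
    (n T : ℕ)
    (step : ∀ i < n, ∀ μ, Inv i μ →
      e.eval x μ ≠ 0 ∧ ∃ s ν, Exec x P μ s ν ∧ s ≤ T ∧ Inv (i + 1) ν)
    (hdone : ∀ μ, Inv n μ → e.eval x μ = 0) (μ : Memory) (hμ : Inv 0 μ) :
    ∃ s ν, Exec x (.loop e P) μ s ν ∧ s ≤ n * (e.cost + 1 + T) + (e.cost + 1) ∧ Inv n ν := by
  have key : ∀ k i, i + k = n → ∀ μ, Inv i μ →
      ∃ s ν, Exec x (.loop e P) μ s ν ∧ s ≤ k * (e.cost + 1 + T) + (e.cost + 1) ∧ Inv n ν := by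
    intro k
    induction k with
    | zero =>
      rintro i rfl μ hi
      exact ⟨_, μ, Exec.loop_stop (hdone μ hi), by omega, hi⟩
    | succ k ih =>
      intro i hik μ hi
      obtain ⟨he, s, ν, hex, hs, hν⟩ := step i (by omega) μ hi
      obtain ⟨s', ν', hex', hs', hν'⟩ := ih (i + 1) (by omega) ν hν
      refine ⟨_, ν', .loop_step he hex hex', ?_, hν'⟩
      rw [Nat.succ_mul]
      omega
  exact key n 0 (by omega) μ hμ

/-! ### A language of terms with bounded sums -/

/-- What the value of a term depends on: the input, a table, and the values of the variables,
the innermost one first. -/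
structure Ctx where
  x : List ℕ
  tab : ℕ → ℕ
  ρ : List ℕ

namespace Ctx

/-- Bind a new variable. -/
def push (c : Ctx) (i : ℕ) : Ctx := { c with ρ := i :: c.ρ }

/-- Forget the innermost variable. -/
def pop (c : Ctx) : Ctx := { c with ρ := c.ρ.tail }

/-- The value of the innermost variable. -/
def top (c : Ctx) : ℕ := c.ρ.getD 0 0

end Ctx

/-- Bounded summation is the only form of iteration. It yields products, quotients and bounded
quantifiers, while polynomial bounds follow by structural induction. -/
inductive Term : Type
  | var (i : ℕ) : Term
  | const (n : ℕ) : Term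
  | read (t : Term) : Term
  | tab (t : Term) : Term
  | add (s t : Term) : Term
  | sub (s t : Term) : Term
  /-- the sum of the values of `t`, with the innermost variable running below the value of `b` -/
  | sum (b t : Term) : Term

namespace Term

def eval : Term → Ctx → ℕ
  | .var i, c => c.ρ.getD i 0
  | .const n, _ => n
  | .read t, c => c.x.getD (t.eval c) 0
  | .tab t, c => c.tab (t.eval c)
  | .add s t, c => s.eval c + t.eval c
  | .sub s t, c => s.eval c - t.eval c
  | .sum b t, c => ∑ i ∈ Finset.range (b.eval c), t.eval (c.push i)

/-- The number of memory cells that the evaluation of a term may use. -/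
def cells : Term → ℕ
  | .var _ => 1
  | .const _ => 1
  | .read t => t.cells
  | .tab t => t.cells
  | .add s t => s.cells + t.cells + 1
  | .sub s t => s.cells + t.cells + 1
  | .sum b t => b.cells + t.cells + 4

/-- A program that writes the value of a term to the cell `d`. The table starts at the cell `K`,
the variables are in the cells `σ`, and the cells below `d` are left alone. -/
def compile (K : ℕ) : Term → List ℕ → ℕ → Program
  | .var i, σ, d => .store (.const d) (if h : i < σ.length then .load (.const σ[i]) else .const 0)
  | .const n, _, d => .store (.const d) (.const n)
  | .read t, σ, d => .seq (t.compile K σ d) (.store (.const d) (.read (.load (.const d))))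
  | .tab t, σ, d =>
      .seq (t.compile K σ d) (.store (.const d) (.load (.add (.const K) (.load (.const d)))))
  | .add s t, σ, d =>
      .seq (.seq (s.compile K σ d) (t.compile K σ (d + 1)))
        (.store (.const d) (.add (.load (.const d)) (.load (.const (d + 1)))))
  | .sub s t, σ, d =>
      .seq (.seq (s.compile K σ d) (t.compile K σ (d + 1)))
        (.store (.const d) (.sub (.load (.const d)) (.load (.const (d + 1)))))
  -- Cell `d` holds the bound, `d + 1` the partial sum and `d + 2` the index, which becomes the
  -- innermost variable; the summand is evaluated from `d + 3` on.
  | .sum b t, σ, d =>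
      .seq (.seq (b.compile K σ d)
          (.seq (.store (.const (d + 1)) (.const 0)) (.store (.const (d + 2)) (.const 0))))
        (.seq
          (.loop (.sub (.load (.const d)) (.load (.const (d + 2))))
            (.seq (t.compile K ((d + 2) :: σ) (d + 3))
              (.seq (.store (.const (d + 1))
                  (.add (.load (.const (d + 1))) (.load (.const (d + 3)))))
                (.store (.const (d + 2)) (.add (.load (.const (d + 2))) (.const 1))))))
          (.store (.const d) (.load (.const (d + 1)))))

/-- `P` writes the value `v` to the cell `d` within `T` time units and leaves the cells below `d`
and those from `K` on alone. -/
def Writes (x : List ℕ) (P : Program) (μ : Memory) (K d T v : ℕ) : Prop :=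
  ∃ s ν, Exec x P μ s ν ∧ s ≤ T ∧ ν d = v ∧ (∀ i < d, ν i = μ i) ∧ ∀ i, ν (K + i) = μ (K + i)

theorem cells_pos (t : Term) : 0 < t.cells := by
  induction t <;> simp only [cells] <;> omega

theorem Writes.store {x : List ℕ} {P : Program} {μ : Memory} {K d T v : ℕ} {e : Expr} (hd : d < K)
    (h : Writes x P μ K d T v) {w : ℕ}
    (hw : ∀ ν : Memory, ν d = v → (∀ i, ν (K + i) = μ (K + i)) → e.eval x ν = w) :
    Writes x (.seq P (.store (.const d) e)) μ K d (T + e.cost + 2) w := by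
  obtain ⟨s, ν, hex, hs, hv, hlow, hhigh⟩ := h
  refine ⟨_, _, .seq hex (.store _ _ _), ?_, ?_, ?_, ?_⟩
  · simp only [Expr.cost]; omega
  · simp [Expr.eval, hw ν hv hhigh]
  · intro i hi
    simp only [Expr.eval]
    rw [Function.update_of_ne (by omega), hlow i hi]
  · intro i
    simp only [Expr.eval]
    rw [Function.update_of_ne (by omega), hhigh i]

/-- The second operand is computed from cell `d + 1` upwards, so the first one survives in cell `d`.
-/
theorem Writes.binary {x : List ℕ} {P Q : Program} {μ : Memory} {K d T T' v v' w : ℕ} {e : Expr}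
    (hd : d + 1 < K) (h : Writes x P μ K d T v)
    (h' : ∀ ν : Memory, (∀ i < d, ν i = μ i) → (∀ i, ν (K + i) = μ (K + i)) →
      Writes x Q ν K (d + 1) T' v')
    (hw : ∀ ν : Memory, ν d = v → ν (d + 1) = v' → e.eval x ν = w) :
    Writes x (.seq (.seq P Q) (.store (.const d) e)) μ K d (T + T' + e.cost + 2) w := by
  obtain ⟨s, ν, hex, hs, hv, hlow, hhigh⟩ := h
  obtain ⟨s', ν', hex', hs', hv', hlow', hhigh'⟩ := h' ν hlow hhigh
  refine ⟨_, _, .seq (.seq hex hex') (.store _ _ _), ?_, ?_, ?_, ?_⟩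
  · simp only [Expr.cost]; omega
  · simp only [Expr.eval, Function.update_self]
    exact hw ν' (by rw [hlow' d (by omega), hv]) hv'
  · intro i hi
    simp only [Expr.eval]
    rw [Function.update_of_ne (by omega), hlow' i (by omega), hlow i hi]
  · intro i
    simp only [Expr.eval]
    rw [Function.update_of_ne (by omega), hhigh' i, hhigh i]

/-- Terms are evaluated in polynomial time, and their values are polynomially bounded. -/
theorem exists_poly (t : Term) : ∃ q : Polynomial ℕ, ∀ (K : ℕ) (x : List ℕ) (μ : Memory)
    (σ : List ℕ) (d N : ℕ), (∀ s ∈ σ, s < d) → d + t.cells ≤ K → (∀ v ∈ x, v ≤ N) →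
    (∀ i, μ (K + i) ≤ N) → (∀ s ∈ σ, μ s ≤ N) →
    t.eval ⟨x, fun i => μ (K + i), σ.map μ⟩ ≤ q.eval N ∧
    Writes x (t.compile K σ d) μ K d (q.eval N)
      (t.eval ⟨x, fun i => μ (K + i), σ.map μ⟩) := by
  induction t with
  | var i =>
    refine ⟨.X + 4, fun K x μ σ d N hσ hK hx htab hμ => ?_⟩
    simp only [cells] at hK
    simp only [eval, compile]
    by_cases h : i < σ.length
    · have h1 : (List.map μ σ).getD i 0 = μ σ[i] := by simp [h]
      have h2 := hμ _ (List.getElem_mem h)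
      simp only [h1, Polynomial.eval_add, Polynomial.eval_X, Polynomial.eval_ofNat]
      refine ⟨by omega, _, _, .store _ _ _, ?_, ?_, ?_, ?_⟩
      · simp [h, Expr.cost]
      · simp [h, Expr.eval]
      · intro j hj
        simp only [Expr.eval]
        rw [Function.update_of_ne (by omega)]
      · intro j
        simp only [Expr.eval]
        rw [Function.update_of_ne (by omega)]
    · have h1 : (List.map μ σ).getD i 0 = 0 := by simp [h]
      simp only [h1, Polynomial.eval_add, Polynomial.eval_X, Polynomial.eval_ofNat]
      refine ⟨by omega, _, _, .store _ _ _, ?_, ?_, ?_, ?_⟩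
      · simp [h, Expr.cost]
      · simp [h, Expr.eval]
      · intro j hj
        simp only [Expr.eval]
        rw [Function.update_of_ne (by omega)]
      · intro j
        simp only [Expr.eval]
        rw [Function.update_of_ne (by omega)]
  | const n =>
    refine ⟨.C n + 3, fun K x μ σ d N hσ hK hx htab hμ => ?_⟩
    simp only [cells] at hK
    simp only [eval, compile, Polynomial.eval_add, Polynomial.eval_C, Polynomial.eval_ofNat]
    refine ⟨by omega, _, _, .store _ _ _, ?_, ?_, ?_, ?_⟩
    · simp [Expr.cost]
    · simp [Expr.eval]
    · intro j hj
      simp only [Expr.eval]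
      rw [Function.update_of_ne (by omega)]
    · intro j
      simp only [Expr.eval]
      rw [Function.update_of_ne (by omega)]
  | read t ih =>
    obtain ⟨q, hq⟩ := ih
    refine ⟨q + .X + 10, fun K x μ σ d N hσ hK hx htab hμ => ?_⟩
    simp only [cells] at hK
    have := t.cells_pos
    obtain ⟨h1, h2⟩ := hq K x μ σ d N hσ hK hx htab hμ
    simp only [eval, compile, Polynomial.eval_add, Polynomial.eval_X, Polynomial.eval_ofNat]
    constructor
    · rw [List.getD_eq_getElem?_getD]
      rcases h : x[t.eval ⟨x, fun i => μ (K + i), σ.map μ⟩]? with _ | v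
      · simp
      · have := hx v (List.mem_of_getElem? h)
        simp; omega
    · obtain ⟨s, ν, a, b, c⟩ := h2.store (e := .read (.load (.const d))) (by omega)
        (w := x.getD (t.eval ⟨x, fun i => μ (K + i), σ.map μ⟩) 0)
        (fun ν hν _ => by simp [Expr.eval, hν])
      exact ⟨s, ν, a, by simp only [Expr.cost] at b; omega, c⟩
  | tab t ih =>
    obtain ⟨q, hq⟩ := ih
    refine ⟨q + .X + 10, fun K x μ σ d N hσ hK hx htab hμ => ?_⟩
    simp only [cells] at hK
    have := t.cells_pos
    obtain ⟨h1, h2⟩ := hq K x μ σ d N hσ hK hx htab hμ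
    simp only [eval, compile, Polynomial.eval_add, Polynomial.eval_X, Polynomial.eval_ofNat]
    constructor
    · have := htab (t.eval ⟨x, fun i => μ (K + i), σ.map μ⟩)
      omega
    · obtain ⟨s, ν, a, b, c⟩ := h2.store
        (e := .load (.add (.const K) (.load (.const d)))) (by omega)
        (w := μ (K + t.eval ⟨x, fun i => μ (K + i), σ.map μ⟩))
        (fun ν hν h => by simp [Expr.eval, hν, h])
      exact ⟨s, ν, a, by simp only [Expr.cost] at b; omega, c⟩
  | add a b iha ihb =>
    obtain ⟨qa, ha⟩ := iha
    obtain ⟨qb, hb⟩ := ihb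
    refine ⟨qa + qb + 10, fun K x μ σ d N hσ hK hx htab hμ => ?_⟩
    simp only [cells] at hK
    have := a.cells_pos
    have := b.cells_pos
    obtain ⟨h1, h2⟩ := ha K x μ σ d N hσ (by omega) hx htab hμ
    have h3 := (hb K x μ σ (d + 1) N (fun s hs => (hσ s hs).trans (by omega)) (by omega)
      hx htab hμ).1
    simp only [eval, compile, Polynomial.eval_add, Polynomial.eval_ofNat]
    refine ⟨by omega, ?_⟩
    obtain ⟨s, ν, a, b, c⟩ := h2.binary (by omega) (Q := b.compile K σ (d + 1)) (T' := qb.eval N)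
      (v' := b.eval ⟨x, fun i => μ (K + i), σ.map μ⟩)
      (e := .add (.load (.const d)) (.load (.const (d + 1))))
      (fun ν hl hh => by
        have e1 : σ.map ν = σ.map μ := List.map_congr_left fun s hs => hl s (hσ s hs)
        have := (hb K x ν σ (d + 1) N (fun s hs => (hσ s hs).trans (by omega)) (by omega)
          hx (fun i => hh i ▸ htab i) (fun s hs => hl s (hσ s hs) ▸ hμ s hs)).2
        simpa only [e1, hh] using this)
      (fun ν e1 e2 => by simp only [Expr.eval, e1, e2]; rfl)
    exact ⟨s, ν, a, by simp only [Expr.cost] at b; omega, c⟩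
  | sub a b iha ihb =>
    obtain ⟨qa, ha⟩ := iha
    obtain ⟨qb, hb⟩ := ihb
    refine ⟨qa + qb + 10, fun K x μ σ d N hσ hK hx htab hμ => ?_⟩
    simp only [cells] at hK
    have := a.cells_pos
    have := b.cells_pos
    obtain ⟨h1, h2⟩ := ha K x μ σ d N hσ (by omega) hx htab hμ
    simp only [eval, compile, Polynomial.eval_add, Polynomial.eval_ofNat]
    refine ⟨by omega, ?_⟩
    obtain ⟨s, ν, a, b, c⟩ := h2.binary (by omega) (Q := b.compile K σ (d + 1)) (T' := qb.eval N)
      (v' := b.eval ⟨x, fun i => μ (K + i), σ.map μ⟩)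
      (e := .sub (.load (.const d)) (.load (.const (d + 1))))
      (fun ν hl hh => by
        have e1 : σ.map ν = σ.map μ := List.map_congr_left fun s hs => hl s (hσ s hs)
        have := (hb K x ν σ (d + 1) N (fun s hs => (hσ s hs).trans (by omega)) (by omega)
          hx (fun i => hh i ▸ htab i) (fun s hs => hl s (hσ s hs) ▸ hμ s hs)).2
        simpa only [e1, hh] using this)
      (fun ν e1 e2 => by simp only [Expr.eval, e1, e2]; rfl)
    exact ⟨s, ν, a, by simp only [Expr.cost] at b; omega, c⟩
  | sum b t ihb iht =>
    obtain ⟨qb, hb⟩ := ihb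
    obtain ⟨qt, ht⟩ := iht
    -- The index stays below the value of the bound, which is at most `qb.eval N`; so all data seen
    -- by the summand are at most `N + qb.eval N`, whence the composition. The constants are slack
    -- for the bookkeeping.
    refine ⟨qb + qb * (qt.comp (.X + qb) + 30) + 30, fun K x μ σ d N hσ hK hx htab hμ => ?_⟩
    simp only [cells] at hK
    have := b.cells_pos
    have := t.cells_pos
    obtain ⟨h1, s, ν, hex, hs, hv, hlow, hhigh⟩ := hb K x μ σ d N hσ (by omega) hx htab hμ
    set c : Ctx := ⟨x, fun i => μ (K + i), σ.map μ⟩ with hc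
    set n := b.eval c with hn
    set N' := N + qb.eval N with hN'
    simp only [eval, compile, Polynomial.eval_add, Polynomial.eval_ofNat, Polynomial.eval_mul,
      Polynomial.eval_comp, Polynomial.eval_X, ← hN', ← hn]
    have hval : ∀ ν : Memory, (∀ i < d, ν i = μ i) → (∀ i, ν (K + i) = μ (K + i)) →
        ν (d + 2) < n → t.eval (c.push (ν (d + 2))) ≤ qt.eval N' ∧
        Writes x (t.compile K ((d + 2) :: σ) (d + 3)) ν K (d + 3) (qt.eval N')
          (t.eval (c.push (ν (d + 2)))) := by
      intro ν hl hh hi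
      have e1 : σ.map ν = σ.map μ := List.map_congr_left fun s hs => hl s (hσ s hs)
      have := ht K x ν ((d + 2) :: σ) (d + 3) N'
        (by
          intro s hs
          rcases List.mem_cons.1 hs with rfl | hs
          · omega
          · have := hσ s hs
            omega)
        (by omega) (fun v hv => (hx v hv).trans (by omega))
        (fun i => by have := htab i; rw [hh i]; omega)
        (by
          intro s hs
          rcases List.mem_cons.1 hs with rfl | hs
          · omega
          · have := hμ s hs
            rw [hl s (hσ s hs)]
            omega)
      simpa only [List.map_cons, e1, hh, hc, Ctx.push] using this
    have hval' : ∀ i < n, t.eval (c.push i) ≤ qt.eval N' := by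
      intro i hi
      -- The value bound for an arbitrary index comes from a hypothetical memory that holds this
      -- index in its cell.
      have := (hval (Function.update μ (d + 2) i)
        (fun j hj => Function.update_of_ne (by omega) _ _)
        (fun j => Function.update_of_ne (by omega) _ _) (by simpa using hi)).1
      simpa using this
    constructor
    · have h2 : ∑ i ∈ Finset.range n, t.eval (c.push i) ≤ n * qt.eval N' := by
        refine (Finset.sum_le_card_nsmul _ _ (qt.eval N')
          fun i hi => hval' i (Finset.mem_range.1 hi)).trans (by simp)
      have h3 : n * qt.eval N' ≤ qb.eval N * (qt.eval N' + 30) :=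
        Nat.mul_le_mul h1 (by omega)
      omega
    · let Inv : ℕ → Memory → Prop := fun i ν => ν d = n ∧ ν (d + 2) = i ∧
        ν (d + 1) = ∑ i ∈ Finset.range i, t.eval (c.push i) ∧
        (∀ i < d, ν i = μ i) ∧ ∀ i, ν (K + i) = μ (K + i)
      obtain ⟨s', ν', hex', hs', -, -, hv', hlow', hhigh'⟩ := exists_exec_loop (x := x)
        (e := .sub (.load (.const d)) (.load (.const (d + 2))))
        (P := .seq (t.compile K ((d + 2) :: σ) (d + 3))
              (.seq (.store (.const (d + 1))
                  (.add (.load (.const (d + 1))) (.load (.const (d + 3)))))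
                (.store (.const (d + 2)) (.add (.load (.const (d + 2))) (.const 1)))))
        Inv n (qt.eval N' + 20)
        (by
          rintro i hi ν ⟨hd, hd2, hd1, hl, hh⟩
          refine ⟨by simp [Expr.eval, hd, hd2]; omega, ?_⟩
          obtain ⟨-, s, ξ, hex, hs, hv, hl', hh'⟩ := hval ν hl hh (by omega)
          refine ⟨_, _, .seq hex (.seq (.store _ _ _) (.store _ _ _)), ?_, ?_⟩
          · simp only [Expr.cost]; omega
          · simp only [Expr.eval, Inv]
            have a0 := hl' d (by omega)
            have a1 := hl' (d + 1) (by omega)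
            have a2 := hl' (d + 2) (by omega)
            refine ⟨?_, ?_, ?_, ?_, ?_⟩
            · rw [Function.update_of_ne (by omega), Function.update_of_ne (by omega), a0, hd]
            · rw [Function.update_self, Function.update_of_ne (by omega), a2, hd2]
            · rw [Function.update_of_ne (by omega), Function.update_self, a1, hd1, hv, hd2,
                Finset.sum_range_succ]
            · intro j hj
              rw [Function.update_of_ne (by omega), Function.update_of_ne (by omega),
                hl' j (by omega), hl j hj]
            · intro j
              rw [Function.update_of_ne (by omega), Function.update_of_ne (by omega),
                hh' j, hh j])
        (by
          rintro ν ⟨hd, hd2, -⟩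
          simp [Expr.eval, hd, hd2])
        (Function.update (Function.update ν (d + 1) 0) (d + 2) 0)
        (by
          refine ⟨?_, ?_, ?_, ?_, ?_⟩
          · rw [Function.update_of_ne (by omega), Function.update_of_ne (by omega), hv]
          · rw [Function.update_self]
          · rw [Function.update_of_ne (by omega), Function.update_self]
            simp
          · intro j hj
            rw [Function.update_of_ne (by omega), Function.update_of_ne (by omega), hlow j hj]
          · intro j
            rw [Function.update_of_ne (by omega), Function.update_of_ne (by omega), hhigh j])
      refine ⟨_, _, .seq (.seq hex (.seq (.store _ _ _) (.store _ _ _)))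
        (.seq hex' (.store _ _ _)), ?_, ?_, ?_, ?_⟩
      · have h3 : n * (6 + (qt.eval N' + 20)) ≤ qb.eval N * (qt.eval N' + 30) :=
          Nat.mul_le_mul h1 (by omega)
        norm_num [Expr.cost] at hs' ⊢
        omega
      · simp only [Expr.eval, Function.update_self]
        exact hv'
      · intro i hi
        simp only [Expr.eval]
        rw [Function.update_of_ne (by omega), hlow' i hi]
      · intro i
        simp only [Expr.eval]
        rw [Function.update_of_ne (by omega), hhigh' i]

end Term

end RAM

/-! ### Deciding a problem by filling a table. -/

namespace RAM

open Term in
/-- A problem is solvable in polynomial time if a yes-answer can be read off by a term from a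
polynomially long table of zeros and ones, each of whose entries is given by a term that depends
on the preceding entries. -/
theorem polyTimeSolvable_of_terms {α : Type} {encode : α → List ℕ} {Yes : α → Prop}
    (size φ ψ : Term) (f : α → ℕ → ℕ)
    (hN : ∀ I, ∀ v ∈ encode I, v ≤ inputLength (encode I)) (hf : ∀ I v, f I v ≤ 1)
    (hφ : ∀ I v tab, v < size.eval ⟨encode I, fun _ => 0, []⟩ → (∀ u < v, tab u = f I u) →
      φ.eval ⟨encode I, tab, [v]⟩ = f I v)
    (hψ : ∀ I tab, (∀ u < size.eval ⟨encode I, fun _ => 0, []⟩, tab u = f I u) →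
      (ψ.eval ⟨encode I, tab, []⟩ ≠ 0 ↔ Yes I)) :
    PolyTimeSolvable encode Yes := by
  obtain ⟨qs, hqs⟩ := size.exists_poly
  obtain ⟨qφ, hqφ⟩ := φ.exists_poly
  obtain ⟨qψ, hqψ⟩ := ψ.exists_poly
  set K := 2 + size.cells + φ.cells + ψ.cells with hK
  have := size.cells_pos
  have := φ.cells_pos
  have := ψ.cells_pos
  -- Cell `0` is the loop counter and finally the answer, cell `1` the length of the table; scratch
  -- cells lie below `K`, where the table starts. The argument `X + qs + 1` bounds the input, the
  -- counter and the entries of the table together.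
  refine ⟨.seq (size.compile K [] 1)
    (.seq (.loop (.sub (.load (.const 1)) (.load (.const 0)))
      (.seq (φ.compile K [0] 2)
        (.seq (.store (.add (.const K) (.load (.const 0))) (.load (.const 2)))
          (.store (.const 0) (.add (.load (.const 0)) (.const 1))))))
    (.seq (ψ.compile K [] 2) (.store (.const 0) (.load (.const 2))))),
    qs + qs * (qφ.comp (.X + qs + 1) + 40) + qψ.comp (.X + qs + 1) + 40, fun I => ?_⟩
  set x := encode I
  set N := inputLength x
  set M := size.eval ⟨x, fun _ => 0, []⟩
  have hx : ∀ v ∈ x, v ≤ N := hN I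
  obtain ⟨hM, s₁, ν₁, hex₁, hs₁, hv₁, hlow₁, hhigh₁⟩ : M ≤ qs.eval N ∧ _ :=
    hqs K x (fun _ => 0) [] 1 N (by simp) (by omega) hx (by simp) (by simp)
  have hv₁ : ν₁ 1 = M := hv₁
  simp only [Polynomial.eval_add, Polynomial.eval_ofNat, Polynomial.eval_mul,
    Polynomial.eval_comp, Polynomial.eval_X, Polynomial.eval_one]
  set N' := N + qs.eval N + 1
  let Inv : ℕ → Memory → Prop := fun i ν => ν 0 = i ∧ ν 1 = M ∧
    ∀ u, ν (K + u) = if u < i then f I u else 0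
  have htab : ∀ {i ν}, Inv i ν → ∀ u, ν (K + u) ≤ N' := by
    rintro i ν ⟨-, -, h⟩ u
    have := hf I u
    rw [h]
    split_ifs <;> omega
  obtain ⟨s₂, ν₂, hex₂, hs₂, hν₂⟩ := exists_exec_loop (x := x)
    (e := .sub (.load (.const 1)) (.load (.const 0)))
    (P := .seq (φ.compile K [0] 2)
        (.seq (.store (.add (.const K) (.load (.const 0))) (.load (.const 2)))
          (.store (.const 0) (.add (.load (.const 0)) (.const 1)))))
    Inv M (qφ.eval N' + 20)
    (by
      intro i hi ν hν
      obtain ⟨h0, h1, ht⟩ := id hν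
      refine ⟨by simp [Expr.eval, h0, h1]; omega, ?_⟩
      obtain ⟨-, s, ξ, hex, hs, hv, hlow, hhigh⟩ := hqφ K x ν [0] 2 N' (by simp) (by omega)
        (fun v hv => (hx v hv).trans (by omega)) (htab hν) (by simp [h0]; omega)
      refine ⟨_, _, .seq hex (.seq (.store _ _ _) (.store _ _ _)), ?_, ?_⟩
      · simp only [Expr.cost]; omega
      · have a0 := hlow 0 (by omega)
        have a1 := hlow 1 (by omega)
        simp only [Expr.eval, Inv]
        have h2 : ξ 2 = f I i := by
          rw [hv, List.map_singleton, h0]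
          exact hφ I i _ hi fun u hu => by rw [ht, if_pos hu]
        rw [Function.update_self, Function.update_of_ne (by omega),
          Function.update_of_ne (by omega), Function.update_of_ne (by omega), a0, a1]
        refine ⟨by omega, by omega, fun u => ?_⟩
        rw [Function.update_of_ne (by omega)]
        rcases eq_or_ne u i with rfl | hu
        · rw [h0, Function.update_self, h2, if_pos (by omega)]
        · rw [Function.update_of_ne (by omega), hhigh, ht]
          exact if_congr (by omega) rfl rfl)
    (by
      rintro ν ⟨h0, h1, -⟩
      simp [Expr.eval, h0, h1])
    ν₁ ⟨hlow₁ 0 (by omega), hv₁, fun u => by simp [hhigh₁]⟩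
  obtain ⟨-, s₃, ν₃, hex₃, hs₃, hv₃, -, -⟩ := hqψ K x ν₂ [] 2 N' (by simp) (by omega)
    (fun v hv => (hx v hv).trans (by omega)) (htab hν₂) (by simp)
  refine ⟨_, _, .seq hex₁ (.seq hex₂ (.seq hex₃ (.store _ _ _))), ?_, ?_⟩
  · have h3 : M * (6 + (qφ.eval N' + 20)) ≤ qs.eval N * (qφ.eval N' + 40) :=
      Nat.mul_le_mul hM (by omega)
    norm_num [Expr.cost] at hs₂ ⊢
    omega
  · simp only [Expr.eval, Function.update_self, hv₃]
    exact hψ I _ fun u hu => by rw [hν₂.2.2, if_pos hu]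

/-! ### Functions given by terms -/

/-- Exchange the variables. -/
def Term.rename (g : ℕ → ℕ) : Term → Term
  | .var i => .var (g i)
  | .const n => .const n
  | .read t => .read (t.rename g)
  | .tab t => .tab (t.rename g)
  | .add s t => .add (s.rename g) (t.rename g)
  | .sub s t => .sub (s.rename g) (t.rename g)
  | .sum b t => .sum (b.rename g) (t.rename fun i => i.casesOn 0 fun j => g j + 1)

theorem Term.eval_rename (t : Term) (g : ℕ → ℕ) (x : List ℕ) (tab : ℕ → ℕ) (ρ ρ' : List ℕ)
    (h : ∀ i, ρ'.getD (g i) 0 = ρ.getD i 0) :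
    (t.rename g).eval ⟨x, tab, ρ'⟩ = t.eval ⟨x, tab, ρ⟩ := by
  induction t generalizing g ρ ρ' with
  | var i => exact h i
  | const n => rfl
  | read t ih => simp only [rename, eval, ih g ρ ρ' h]
  | tab t ih => simp only [rename, eval, ih g ρ ρ' h]
  | add a b iha ihb => simp only [rename, eval, iha g ρ ρ' h, ihb g ρ ρ' h]
  | sub a b iha ihb => simp only [rename, eval, iha g ρ ρ' h, ihb g ρ ρ' h]
  | sum b t ihb iht =>
    simp only [rename, eval, ihb g ρ ρ' h]
    refine Finset.sum_congr rfl fun k _ => iht _ _ _ fun i => ?_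
    cases i with
    | zero => rfl
    | succ i => simpa using h i

/-- The function is given by a term. -/
def IsTerm (f : Ctx → ℕ) : Prop := ∃ t : Term, ∀ c, t.eval c = f c

namespace IsTerm

variable {f g h : Ctx → ℕ}

theorem top : IsTerm Ctx.top := ⟨.var 0, fun _ => rfl⟩

theorem const (n : ℕ) : IsTerm fun _ => n := ⟨.const n, fun _ => rfl⟩

theorem add (hf : IsTerm f) (hg : IsTerm g) : IsTerm fun c => f c + g c := by
  obtain ⟨s, hs⟩ := hf
  obtain ⟨t, ht⟩ := hg
  exact ⟨.add s t, fun c => by simp only [Term.eval, hs, ht]⟩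

theorem sub (hf : IsTerm f) (hg : IsTerm g) : IsTerm fun c => f c - g c := by
  obtain ⟨s, hs⟩ := hf
  obtain ⟨t, ht⟩ := hg
  exact ⟨.sub s t, fun c => by simp only [Term.eval, hs, ht]⟩

theorem read (hf : IsTerm f) : IsTerm fun c => c.x.getD (f c) 0 := by
  obtain ⟨s, hs⟩ := hf
  exact ⟨.read s, fun c => by simp only [Term.eval, hs]⟩

theorem tab (hf : IsTerm f) : IsTerm fun c => c.tab (f c) := by
  obtain ⟨s, hs⟩ := hf
  exact ⟨.tab s, fun c => by simp only [Term.eval, hs]⟩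

theorem pop (hf : IsTerm f) : IsTerm fun c => f c.pop := by
  obtain ⟨s, hs⟩ := hf
  refine ⟨s.rename Nat.succ, fun c => ?_⟩
  change _ = f c.pop
  rw [← hs]
  refine s.eval_rename _ _ _ c.ρ.tail c.ρ fun i => ?_
  cases h : c.ρ <;> simp

theorem sum {b : Ctx → ℕ} {F : Ctx → ℕ → ℕ} (hb : IsTerm b)
    (hF : IsTerm fun c => F c.pop c.top) :
    IsTerm fun c => ∑ i ∈ Finset.range (b c), F c i := by
  obtain ⟨s, hs⟩ := hb
  obtain ⟨t, ht⟩ := hF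
  refine ⟨.sum s t, fun c => ?_⟩
  simp only [Term.eval, hs, ht]
  rfl

theorem congr (hf : IsTerm f) (h : ∀ c, f c = g c) : IsTerm g := by
  obtain ⟨s, hs⟩ := hf
  exact ⟨s, fun c => (hs c).trans (h c)⟩

theorem mul (hf : IsTerm f) (hg : IsTerm g) : IsTerm fun c => f c * g c :=
  (sum (F := fun c _ => g c) hf hg.pop).congr fun c => by simp

/-- The exponent is a fixed number: with a variable exponent the values would not be polynomially
bounded. -/
theorem pow (hf : IsTerm f) (n : ℕ) : IsTerm fun c => f c ^ n := by
  induction n with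
  | zero => exact (const 1).congr fun c => by simp
  | succ n ih => exact (ih.mul hf).congr fun c => by simp [pow_succ]

/-- An unrolled sum of constant length. The summands may come from different terms, such as powers
with different exponents. -/
theorem sum_range {F : Ctx → ℕ → ℕ} (n : ℕ) (hF : ∀ i, IsTerm fun c => F c i) :
    IsTerm fun c => ∑ i ∈ Finset.range n, F c i := by
  induction n with
  | zero => exact (const 0).congr fun c => by simp
  | succ n ih => exact (ih.add (hF n)).congr fun c => by simp [Finset.sum_range_succ]

end IsTerm

open Classical in
/-- The indicator of the predicate is given by a term. -/
def IsTermPred (p : Ctx → Prop) : Prop := IsTerm fun c => if p c then 1 else 0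

namespace IsTermPred

variable {f g : Ctx → ℕ} {p q : Ctx → Prop}

theorem congr (hp : IsTermPred p) (h : ∀ c, p c ↔ q c) : IsTermPred q := by
  have : p = q := funext fun c => propext (h c)
  exact this ▸ hp

theorem pop (hp : IsTermPred p) : IsTermPred fun c => p c.pop := IsTerm.pop hp

theorem le (hf : IsTerm f) (hg : IsTerm g) : IsTermPred fun c => f c ≤ g c :=
  ((IsTerm.const 1).sub (hf.sub hg)).congr fun c => by dsimp only; split_ifs <;> omega

theorem lt (hf : IsTerm f) (hg : IsTerm g) : IsTermPred fun c => f c < g c :=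
  le (hf.add (.const 1)) hg

theorem not (hp : IsTermPred p) : IsTermPred fun c => ¬ p c :=
  ((IsTerm.const 1).sub hp).congr fun c => by dsimp only; split_ifs <;> simp_all

theorem and (hp : IsTermPred p) (hq : IsTermPred q) : IsTermPred fun c => p c ∧ q c :=
  (IsTerm.mul hp hq).congr fun c => by dsimp only; split_ifs <;> simp_all

theorem or (hp : IsTermPred p) (hq : IsTermPred q) : IsTermPred fun c => p c ∨ q c :=
  (hp.not.and hq.not).not.congr fun c => by tauto

theorem imp (hp : IsTermPred p) (hq : IsTermPred q) : IsTermPred fun c => p c → q c :=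
  (hp.not.or hq).congr fun c => by tauto

theorem eq (hf : IsTerm f) (hg : IsTerm g) : IsTermPred fun c => f c = g c :=
  ((le hf hg).and (le hg hf)).congr fun c => by omega

theorem ne (hf : IsTerm f) (hg : IsTerm g) : IsTermPred fun c => f c ≠ g c := (eq hf hg).not

/-- The sum of the indicators counts the witnesses, and is positive exactly if there is one. -/
theorem exists_lt {b : Ctx → ℕ} {P : Ctx → ℕ → Prop} (hb : IsTerm b)
    (hP : IsTermPred fun c => P c.pop c.top) : IsTermPred fun c => ∃ i < b c, P c i := by
  classical
  refine (lt (.const 0) (IsTerm.sum (F := fun c i => if P c i then 1 else 0) hb ?_)).congr ?_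
  · exact IsTerm.congr hP fun c => by congr
  · intro c
    simp [pos_iff_ne_zero]

theorem forall_lt {b : Ctx → ℕ} {P : Ctx → ℕ → Prop} (hb : IsTerm b)
    (hP : IsTermPred fun c => P c.pop c.top) : IsTermPred fun c => ∀ i < b c, P c i :=
  (exists_lt (P := fun c i => ¬ P c i) hb hP.not).not.congr fun c => by simp

end IsTermPred

namespace IsTerm

variable {f g : Ctx → ℕ}

theorem ite {p : Ctx → Prop} [DecidablePred p] (hp : IsTermPred p) (hf : IsTerm f) (hg : IsTerm g) :
    IsTerm fun c => if p c then f c else g c :=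
  ((mul hp hf).add (mul hp.not hg)).congr fun c => by dsimp only; split_ifs <;> simp_all

theorem indicator {p : Ctx → Prop} [DecidablePred p] (hp : IsTermPred p) :
    IsTerm fun c => if p c then 1 else 0 :=
  ite hp (const 1) (const 0)

/-- The quotient is the number of positive multiples `(i + 1) * g` not above `f`. The extra
condition `0 < g` gives the default value `0` for division by zero. -/
theorem div (hf : IsTerm f) (hg : IsTerm g) : IsTerm fun c => f c / g c := by
  classical
  refine (sum (F := fun c i => if 0 < g c ∧ (i + 1) * g c ≤ f c then 1 else 0) hf
    (indicator (.and (.lt (const 0) hg.pop)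
      (.le ((top.add (const 1)).mul hg.pop) hf.pop)))).congr fun c => ?_
  rcases Nat.eq_zero_or_pos (g c) with h | h
  · simp [h]
  · have : ∀ i, (0 < g c ∧ (i + 1) * g c ≤ f c) ↔ i < f c / g c := fun i => by
      rw [← Nat.succ_le_iff (n := f c / g c), Nat.le_div_iff_mul_le h]
      simp [h]
    simp only [this]
    rw [← Finset.card_filter]
    have : (Finset.range (f c)).filter (· < f c / g c) = Finset.range (f c / g c) := by
      ext i
      have := Nat.div_le_self (f c) (g c)
      simp only [Finset.mem_filter, Finset.mem_range]
      omega
    rw [this, Finset.card_range]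

theorem mod (hf : IsTerm f) (hg : IsTerm g) : IsTerm fun c => f c % g c :=
  (hf.sub (hg.mul (hf.div hg))).congr fun c => by
    have := Nat.div_add_mod (f c) (g c)
    omega

end IsTerm

end RAM

/-! ### Numbers as sequences of digits -/

/-- The number with the first `s` digits `h 0`, `h 1`, ... in base `B`, the lowest one first. -/
def digitSum (B : ℕ) (h : ℕ → ℕ) (s : ℕ) : ℕ := ∑ i ∈ Finset.range s, h i * B ^ i

theorem digitSum_succ' (B : ℕ) (h : ℕ → ℕ) (s : ℕ) :
    digitSum B h (s + 1) = h 0 + B * digitSum B (fun i => h (i + 1)) s := by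
  simp only [digitSum, Finset.sum_range_succ', Finset.mul_sum, pow_zero, mul_one]
  rw [add_comm]
  congr 1
  exact Finset.sum_congr rfl fun i _ => by ring

theorem digitSum_lt {B : ℕ} {h : ℕ → ℕ} {s : ℕ} (hB : ∀ i, h i < B) : digitSum B h s < B ^ s := by
  induction s with
  | zero => simp [digitSum]
  | succ s ih =>
    rw [digitSum, Finset.sum_range_succ, pow_succ]
    have : (h s + 1) * B ^ s ≤ B * B ^ s := Nat.mul_le_mul_right _ (hB s)
    rw [digitSum] at ih
    nlinarith

theorem digitSum_digit {B : ℕ} {h : ℕ → ℕ} {s i : ℕ} (hB : ∀ i, h i < B) (hi : i < s) :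
    digitSum B h s / B ^ i % B = h i := by
  have h0 : 0 < B := (Nat.zero_le _).trans_lt (hB 0)
  induction i generalizing h s with
  | zero =>
    obtain ⟨s, rfl⟩ := Nat.exists_eq_add_of_lt hi
    rw [zero_add, digitSum_succ', pow_zero, Nat.div_one, Nat.add_mul_mod_self_left,
      Nat.mod_eq_of_lt (hB 0)]
  | succ i ih =>
    obtain ⟨s, rfl⟩ := Nat.exists_eq_add_of_lt hi
    rw [digitSum_succ', pow_succ', ← Nat.div_div_eq_div_mul, Nat.add_mul_div_left _ _ h0,
      Nat.div_eq_of_lt (hB 0), zero_add]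
    exact ih (fun i => hB (i + 1)) (by omega)

theorem digitSum_sum {ι : Type*} (B : ℕ) (S : Finset ι) (h : ι → ℕ → ℕ) (s : ℕ) :
    digitSum B (fun i => ∑ j ∈ S, h j i) s = ∑ j ∈ S, digitSum B (h j) s := by
  simp only [digitSum, Finset.sum_mul]
  exact Finset.sum_comm

/-- The values of `g` at the places below `A`, in descending order, followed by zeros. -/
def window (g : ℕ → ℕ) (A i : ℕ) : ℕ := if i < A then g (A - 1 - i) else 0

theorem window_sum {ι : Type*} (S : Finset ι) (g : ι → ℕ → ℕ) (A i : ℕ) :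
    window (fun q => ∑ j ∈ S, g j q) A i = ∑ j ∈ S, window (g j) A i := by
  unfold window
  split_ifs <;> simp

theorem window_lt {g : ℕ → ℕ} {B : ℕ} (hB : ∀ q, g q < B) (A i : ℕ) : window g A i < B := by
  have := hB (A - 1 - i)
  unfold window
  split_ifs <;> omega

theorem window_succ_zero (g : ℕ → ℕ) (A : ℕ) : window g (A + 1) 0 = g A := by simp [window]

theorem window_succ_succ (g : ℕ → ℕ) (A i : ℕ) : window g (A + 1) (i + 1) = window g A i := by
  unfold window
  have : A - (i + 1) = A - 1 - i := by omega
  simp [this]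

/-- The lowest digit belongs to the highest place `A`. For `r = 0` there is no digit, but then `hg`
makes `g A` vanish. -/
theorem digitSum_window_mod {B r A : ℕ} {g : ℕ → ℕ} (hB : ∀ q, g q < B)
    (hg : ∀ q, q + r ≤ A → g q = 0) : digitSum B (window g (A + 1)) r % B = g A := by
  cases r with
  | zero => simp [digitSum, hg A le_rfl]
  | succ r =>
    rw [digitSum_succ', window_succ_zero, Nat.add_mul_mod_self_left, Nat.mod_eq_of_lt (hB A)]

/-- Removing the lowest digit moves the window down by one place. The place `A - r` that enters, if
there is one, carries `0` by `hg`. -/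
theorem digitSum_window_div {B r A : ℕ} {g : ℕ → ℕ} (hB : ∀ q, g q < B)
    (hg : ∀ q, q + r ≤ A → g q = 0) :
    digitSum B (window g (A + 1)) r / B = digitSum B (window g A) r := by
  have h0 : 0 < B := (Nat.zero_le _).trans_lt (hB 0)
  cases r with
  | zero => simp [digitSum]
  | succ r =>
    rw [digitSum_succ', window_succ_zero, Nat.add_mul_div_left _ _ h0,
      Nat.div_eq_of_lt (hB A), zero_add]
    simp only [window_succ_succ]
    rw [digitSum, digitSum, Finset.sum_range_succ]
    have : window g A r = 0 := by
      unfold window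
      split_ifs
      · exact hg _ (by omega)
      · rfl
    simp [this]

/-! ### Selecting items whose places lie in short windows -/

/-- Items `j` with `j + 1 < B` are selected; `At j a` says that `j` may be selected at the place
`a`. A selected item puts the load `far j q` on the place `q`, and contributes `xt j` to a number
below `BX`. Loads are checked by `chk`, and the number is checked by `fin`. -/
structure SelectionData where
  B : ℕ
  r : ℕ
  BX : ℕ
  At : ℕ → ℕ → Prop
  far : ℕ → ℕ → ℕ
  xt : ℕ → ℕ
  chk : ℕ → ℕ → Prop
  fin : ℕ → Prop

namespace SelectionData

variable (D : SelectionData)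

/-- The loads that `j` puts on the `r` places up to `a`, as digits. -/
def wt (j a : ℕ) : ℕ := digitSum D.B (window (D.far j) (a + 1)) D.r

/-- With `k` steps to go, a selection can be completed; `X` is the sum of the numbers of the items
selected, and the digits of `W` are the loads on the current window. -/
def Feas : ℕ → ℕ → ℕ → Prop
  | 0, X, _ => D.fin X
  | k + 1, X, W =>
    (k % D.B = 0 ∧ D.chk (k / D.B) (W % D.B) ∧ Feas k X (W / D.B)) ∨
    (k % D.B ≠ 0 ∧ (Feas k X W ∨ (D.At (k % D.B - 1) (k / D.B) ∧
      X + D.xt (k % D.B - 1) < D.BX ∧ W + D.wt (k % D.B - 1) (k / D.B) < D.B ^ D.r ∧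
      Feas k (X + D.xt (k % D.B - 1)) (W + D.wt (k % D.B - 1) (k / D.B)))))

/-- The load on the place `q`. -/
def load (S : Finset ℕ) (q : ℕ) : ℕ := ∑ j ∈ S, D.far j q

/-- The loads on the `r` places below `A`, as digits. -/
def loads (S : Finset ℕ) (A : ℕ) : ℕ := digitSum D.B (window (D.load S) A) D.r

/-- `digitSum` is linear in the digits, whether or not they stay below the base. -/
theorem loads_insert {S : Finset ℕ} {j : ℕ} (hj : j ∉ S) (a : ℕ) :
    D.loads (insert j S) (a + 1) = D.loads S (a + 1) + D.wt j a := by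
  have : ∀ S : Finset ℕ, D.loads S (a + 1) = ∑ j ∈ S, D.wt j a := fun S => by
    unfold loads wt load
    rw [← digitSum_sum]
    congr 1
    funext i
    exact window_sum _ _ _ _
  rw [this, this, Finset.sum_insert hj, add_comm]

/-- The items of `E` have unique places below `m`, and they put loads only on the `r` places up to
their place. -/
structure Located (E : Finset ℕ) (loc : ℕ → ℕ) (m : ℕ) : Prop where
  lt : ∀ j ∈ E, j + 1 < D.B
  card : E.card < D.B
  at_iff : ∀ j, j + 1 < D.B → ∀ a < m, D.At j a ↔ j ∈ E ∧ loc j = a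
  loc_lt : ∀ j ∈ E, loc j < m
  far_le : ∀ j q, D.far j q ≤ 1
  far_loc : ∀ j ∈ E, ∀ q, D.far j q ≠ 0 → q ≤ loc j ∧ loc j < q + D.r
  xt_lt : ∀ S ⊆ E, ∑ j ∈ S, D.xt j < D.BX

namespace Located

variable {D} {E : Finset ℕ} {loc : ℕ → ℕ} {m : ℕ} (H : D.Located E loc m)
include H

theorem B_pos : 0 < D.B := (Nat.zero_le _).trans_lt H.card

/-- Each item adds at most `1` and there are fewer than `B` items, so no digit overflows. -/
theorem load_lt {S : Finset ℕ} (hS : S ⊆ E) (q : ℕ) : D.load S q < D.B := by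
  refine lt_of_le_of_lt ?_ H.card
  refine le_trans ?_ (Finset.card_le_card hS)
  simpa [load] using Finset.sum_le_card_nsmul S (fun j => D.far j q) 1 fun j _ => H.far_le j q

theorem loads_lt {S : Finset ℕ} (hS : S ⊆ E) (A : ℕ) : D.loads S A < D.B ^ D.r :=
  digitSum_lt (window_lt (H.load_lt hS) A)

/-- Items placed at `a` or later put no load on places `q` with `q + r ≤ a`, which is the hypothesis
needed to read and shift the window. -/
theorem loads_mod {S : Finset ℕ} (hS : S ⊆ E) {a : ℕ} (ha : ∀ j ∈ S, a ≤ loc j) :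
    D.loads S (a + 1) % D.B = D.load S a := by
  refine digitSum_window_mod (H.load_lt hS) fun q hq => Finset.sum_eq_zero fun j hj => ?_
  by_contra h
  have := H.far_loc j (hS hj) q h
  have := ha j hj
  omega

theorem loads_div {S : Finset ℕ} (hS : S ⊆ E) {a : ℕ} (ha : ∀ j ∈ S, a ≤ loc j) :
    D.loads S (a + 1) / D.B = D.loads S a := by
  refine digitSum_window_div (H.load_lt hS) fun q hq => Finset.sum_eq_zero fun j hj => ?_
  by_contra h
  have := H.far_loc j (hS hj) q h
  have := ha j hj
  omega

omit H in
-- `(k + B - 1) / B` is `k / B` rounded up: the number of places still open when `k` steps remain,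
-- hence the upper end of the window. It drops only at steps whose number is divisible by `B`.
theorem place_succ {k B : ℕ} (hB : 0 < B) : (k + 1 + B - 1) / B = k / B + 1 := by
  rw [show k + 1 + B - 1 = k + B by omega, Nat.add_div_right _ hB]

omit H in
theorem place_of_mod_eq_zero {k B : ℕ} (hB : 0 < B) (hk : k % B = 0) :
    (k + B - 1) / B = k / B := by
  obtain ⟨a, rfl⟩ := Nat.dvd_of_mod_eq_zero hk
  rw [Nat.add_sub_assoc hB, Nat.mul_add_div hB, Nat.mul_div_cancel_left _ hB,
    Nat.div_eq_of_lt (by omega), add_zero]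

omit H in
theorem place_of_mod_ne_zero {k B : ℕ} (hB : 0 < B) (hk : k % B ≠ 0) :
    (k + B - 1) / B = k / B + 1 := by
  have h := Nat.div_add_mod k B
  have hlt := Nat.mod_lt k hB
  generalize k / B = a at *
  generalize k % B = c at *
  rw [← h, show B * a + c + B - 1 = B * (a + 1) + (c - 1) by rw [mul_add]; omega,
    Nat.mul_add_div hB, Nat.div_eq_of_lt (by omega), add_zero]

/-- An item is selected or not at the step with this number. -/
theorem step_div_mod {j : ℕ} (hj : j ∈ E) :
    (loc j * D.B + (j + 1)) / D.B = loc j ∧ (loc j * D.B + (j + 1)) % D.B = j + 1 := by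
  have := H.lt j hj
  rw [mul_comm, Nat.mul_add_div H.B_pos, Nat.mul_add_mod, Nat.div_eq_of_lt this,
    Nat.mod_eq_of_lt this, add_zero]
  exact ⟨rfl, rfl⟩

/-- When `k` steps remain, the items selected so far are those of `S` whose step number is at least
`k`. Induction on `k` follows the recursion from its end, where all of `S` has been selected. -/
theorem feas_of_selection {S : Finset ℕ} (hS : S ⊆ E) (hfin : D.fin (∑ j ∈ S, D.xt j))
    (hchk : ∀ q < m, D.chk q (D.load S q)) (k : ℕ) (hk : k ≤ m * D.B) :
    D.Feas k (∑ j ∈ S with k ≤ loc j * D.B + (j + 1), D.xt j)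
      (D.loads {j ∈ S | k ≤ loc j * D.B + (j + 1)} ((k + D.B - 1) / D.B)) := by
  have hB := H.B_pos
  induction k with
  | zero => simpa [Feas] using hfin
  | succ k ih =>
    specialize ih (by omega)
    have ha : k / D.B < m := Nat.div_lt_of_lt_mul (by rw [mul_comm]; omega)
    rw [place_succ hB]
    have hdm := Nat.div_add_mod k D.B
    have hloc : ∀ j ∈ S, k ≤ loc j * D.B + (j + 1) → k / D.B ≤ loc j := fun j hj h => by
      rw [← (H.step_div_mod (hS hj)).1]
      exact Nat.div_le_div_right h
    have hne : (¬ ∃ j ∈ S, k = loc j * D.B + (j + 1)) →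
        {j ∈ S | k + 1 ≤ loc j * D.B + (j + 1)} = {j ∈ S | k ≤ loc j * D.B + (j + 1)} := by
      intro h
      refine Finset.filter_congr fun j hj => ?_
      have : k ≠ loc j * D.B + (j + 1) := fun hk => h ⟨j, hj, hk⟩
      omega
    by_cases hmod : k % D.B = 0
    · left
      -- A step whose number is divisible by `B` closes a place and decides no item.
      rw [hne (by
        rintro ⟨j, hj, h⟩
        have := (H.step_div_mod (hS hj)).2
        rw [← h] at this
        omega)]
      rw [place_of_mod_eq_zero hB hmod] at ih
      have hsub : {j ∈ S | k ≤ loc j * D.B + (j + 1)} ⊆ E := (Finset.filter_subset _ _).trans hS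
      have hle : ∀ j ∈ {j ∈ S | k ≤ loc j * D.B + (j + 1)}, k / D.B ≤ loc j := fun j hj =>
        hloc j (Finset.mem_filter.1 hj).1 (Finset.mem_filter.1 hj).2
      rw [H.loads_mod hsub hle, H.loads_div hsub hle]
      refine ⟨hmod, ?_, ih⟩
      convert hchk _ ha using 1
      -- Items not yet decided have an earlier place, so they put no load on the place being closed.
      refine Finset.sum_subset (Finset.filter_subset _ _) fun j hj hj' => ?_
      by_contra hfar
      have h1 := H.far_loc j (hS hj) _ hfar
      refine hj' (Finset.mem_filter.2 ⟨hj, ?_⟩)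
      have := Nat.mul_le_mul_right D.B h1.1
      rw [mul_comm] at this
      omega
    · right
      refine ⟨hmod, ?_⟩
      rw [place_of_mod_ne_zero hB hmod] at ih
      by_cases hex : ∃ j ∈ S, k = loc j * D.B + (j + 1)
      · right
        obtain ⟨j, hj, hjk⟩ := hex
        obtain ⟨h1, h2⟩ := H.step_div_mod (hS hj)
        rw [← hjk] at h1 h2
        have hins : {j ∈ S | k ≤ loc j * D.B + (j + 1)} =
            insert j {j ∈ S | k + 1 ≤ loc j * D.B + (j + 1)} := by
          ext i
          simp only [Finset.mem_filter, Finset.mem_insert]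
          constructor
          · rintro ⟨hi, hle⟩
            rcases hle.eq_or_lt with h | h
            · left
              have := (H.step_div_mod (hS hi)).2
              rw [← h] at this
              omega
            · exact Or.inr ⟨hi, h⟩
          · rintro (rfl | ⟨hi, h⟩)
            · exact ⟨hj, hjk.le⟩
            · exact ⟨hi, by omega⟩
        have hnot : j ∉ {j ∈ S | k + 1 ≤ loc j * D.B + (j + 1)} := by
          simp only [Finset.mem_filter]
          omega
        have hsub : {j ∈ S | k ≤ loc j * D.B + (j + 1)} ⊆ E :=
          (Finset.filter_subset _ _).trans hS
        have hX := H.xt_lt _ hsub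
        have hW := H.loads_lt hsub (k / D.B + 1)
        rw [hins, Finset.sum_insert hnot, add_comm (D.xt j), D.loads_insert hnot] at ih
        rw [hins, Finset.sum_insert hnot, add_comm (D.xt j)] at hX
        rw [hins, D.loads_insert hnot] at hW
        rw [show k % D.B - 1 = j by omega]
        exact ⟨(H.at_iff j (H.lt j (hS hj)) _ ha).2 ⟨hS hj, h1.symm⟩, hX, hW, ih⟩
      · left
        rwa [hne hex]

/-- The induction needs an arbitrary partial selection `S`, and needs to know that all items added
to it have step numbers below `k`: these cannot disturb places already closed. -/
theorem selection_of_feas (k : ℕ) (hk : k ≤ m * D.B) (S : Finset ℕ) (hS : S ⊆ E)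
    (hSk : ∀ j ∈ S, k ≤ loc j * D.B + (j + 1))
    (hF : D.Feas k (∑ j ∈ S, D.xt j) (D.loads S ((k + D.B - 1) / D.B))) :
    ∃ S', S ⊆ S' ∧ S' ⊆ E ∧ (∀ j ∈ S', j ∉ S → loc j * D.B + (j + 1) < k) ∧
      D.fin (∑ j ∈ S', D.xt j) ∧ ∀ q, q * D.B < k → D.chk q (D.load S' q) := by
  have hB := H.B_pos
  induction k generalizing S with
  | zero => exact ⟨S, subset_rfl, hS, fun j hj hj' => absurd hj hj', hF, fun q hq => by omega⟩
  | succ k ih =>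
    have ha : k / D.B < m := Nat.div_lt_of_lt_mul (by rw [mul_comm]; omega)
    have hdm := Nat.div_add_mod k D.B
    have hloc : ∀ j ∈ S, k / D.B ≤ loc j := fun j hj => by
      rw [← (H.step_div_mod (hS hj)).1]
      exact Nat.div_le_div_right ((Nat.le_succ k).trans (hSk j hj))
    rw [place_succ hB] at hF
    rcases hF with ⟨hmod, hc, hF⟩ | ⟨hmod, hF⟩
    · rw [H.loads_mod hS hloc] at hc
      rw [H.loads_div hS hloc, ← place_of_mod_eq_zero hB hmod] at hF
      obtain ⟨S', h1, h2, h3, h4, h5⟩ := ih (by omega) S hS (fun j hj => by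
        have := hSk j hj
        omega) hF
      refine ⟨S', h1, h2, fun j hj hj' => (h3 j hj hj').trans (by omega), h4, fun q hq => ?_⟩
      rcases (Nat.lt_succ_iff.1 hq).eq_or_lt with h | h
      · have hqa : q = k / D.B := by rw [← h, Nat.mul_div_cancel _ hB]
        convert hc using 1
        rw [← hqa]
        refine (Finset.sum_subset h1 fun j hj hj' => ?_).symm
        by_contra hfar
        have h6 := (H.far_loc j (h2 hj) _ hfar).1
        have := Nat.mul_le_mul_right D.B h6
        have := h3 j hj hj'
        omega
      · exact h5 q h
    · have hq : ∀ q, q * D.B < k + 1 → q * D.B < k := by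
        intro q hq
        refine lt_of_le_of_ne (by omega) fun h => hmod ?_
        rw [← h, Nat.mul_mod_left]
      rw [← place_of_mod_ne_zero hB hmod] at hF
      rcases hF with hF | ⟨hat, -, -, hF⟩
      · obtain ⟨S', h1, h2, h3, h4, h5⟩ := ih (by omega) S hS (fun j hj => by
          have := hSk j hj
          omega) hF
        exact ⟨S', h1, h2, fun j hj hj' => (h3 j hj hj').trans (by omega), h4,
          fun q h => h5 q (hq q h)⟩
      · set j := k % D.B - 1 with hj
        have hlt := Nat.mod_lt k hB
        obtain ⟨hjE, hja⟩ := (H.at_iff j (by omega) _ ha).1 hat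
        have hjk : loc j * D.B + (j + 1) = k := by
          rw [hja, mul_comm]
          omega
        have hnot : j ∉ S := fun h => by
          have := hSk j h
          omega
        rw [place_of_mod_ne_zero hB hmod, ← D.loads_insert hnot,
          ← place_of_mod_ne_zero hB hmod, add_comm, ← Finset.sum_insert hnot] at hF
        obtain ⟨S', h1, h2, h3, h4, h5⟩ := ih (by omega) (insert j S)
          (Finset.insert_subset hjE hS) (fun i hi => by
            rcases Finset.mem_insert.1 hi with rfl | hi
            · omega
            · have := hSk i hi
              omega) hF
        refine ⟨S', (Finset.subset_insert _ _).trans h1, h2, fun i hi hi' => ?_, h4,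
          fun q h => h5 q (hq q h)⟩
        by_cases hij : i = j
        · subst hij
          omega
        · exact (h3 i hi (by simp [hij, hi'])).trans (by omega)

theorem feas_iff : D.Feas (m * D.B) 0 0 ↔
    ∃ S ⊆ E, D.fin (∑ j ∈ S, D.xt j) ∧ ∀ q < m, D.chk q (D.load S q) := by
  have h0 : ∀ A, D.loads ∅ A = 0 := fun A => by simp [loads, digitSum, window, load]
  constructor
  · intro h
    obtain ⟨S, -, h2, -, h4, h5⟩ := H.selection_of_feas (m * D.B) le_rfl ∅ (by simp) (by simp)
      (by simpa [h0] using h)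
    exact ⟨S, h2, h4, fun q hq => h5 q (Nat.mul_lt_mul_of_pos_right hq H.B_pos)⟩
  · rintro ⟨S, h2, h4, h5⟩
    have := H.feas_of_selection h2 h4 h5 (m * D.B) le_rfl
    have he : {j ∈ S | m * D.B ≤ loc j * D.B + (j + 1)} = ∅ := by
      refine Finset.filter_eq_empty_iff.2 fun j hj => ?_
      have h6 := H.lt j (h2 hj)
      have h7 := Nat.mul_le_mul_right D.B (H.loc_lt j (h2 hj))
      rw [Nat.succ_mul] at h7
      omega
    simpa [he, h0] using this

end Located

end SelectionData

/-! ### Selecting votes -/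

theorem coe_eq_map_getD {α : Type*} (l : List α) (d : α) :
    (l : Multiset α) = (Multiset.range l.length).map fun j => l.getD j d := by
  refine congrArg _ (List.ext_getElem (by simp) fun i h _ => ?_)
  simp [h]

/-- Positions in the list serve as items, so equal votes become distinguishable. -/
theorem le_coe_iff_exists_finset {α : Type*} (l : List α) (d : α) (s : Multiset α) :
    s ≤ l ↔ ∃ S ⊆ Finset.range l.length, s = S.val.map fun j => l.getD j d := by
  constructor
  · intro h
    rw [coe_eq_map_getD l d] at h
    obtain ⟨l₁, rfl⟩ := Quot.exists_rep s
    obtain ⟨l₂, hperm, hsub⟩ := h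
    obtain ⟨l₃, hl₃, rfl⟩ := List.sublist_map_iff.1 hsub
    have hnd : l₃.Nodup := hl₃.nodup List.nodup_range
    refine ⟨⟨l₃, hnd⟩, fun j hj => ?_, ?_⟩
    · exact Finset.mem_range.2 (List.mem_range.1 (hl₃.subset hj))
    · exact (Multiset.coe_eq_coe.2 hperm).symm
  · rintro ⟨S, hS, rfl⟩
    rw [coe_eq_map_getD l d]
    exact Multiset.map_le_map (Finset.val_le_iff.2 hS)

namespace AVInstance

variable {k : ℕ} (r : ℕ) (I : AVInstance k)

/-- The unregistered vote number `j`. -/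
def unregistered (j : ℕ) : Ranking I.m := I.T.getD j 1

/-- The unregistered votes that approve `p`. -/
def helpful : Finset ℕ := {j ∈ Finset.range I.T.length | ((I.unregistered j).symm I.p : ℕ) < r}

/-- The number of votes in `S` that approve `c`. -/
def gain (S : Finset ℕ) (c : Fin I.m) : ℕ :=
  {j ∈ S | ((I.unregistered j).symm c : ℕ) < r}.card

theorem score_add_map (S : Finset ℕ) (c : Fin I.m) :
    score r ((I.V : Multiset (Ranking I.m)) + S.val.map I.unregistered) c =
      score r (I.V : Multiset (Ranking I.m)) c + I.gain r S c := by
  unfold score gain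
  rw [Multiset.countP_add, Multiset.countP_map]
  rfl

theorem isUniqueWinner_iff {m : ℕ} (r : ℕ) (Γ : Multiset (Ranking m)) (c : Fin m) :
    IsUniqueWinner r Γ c ↔ ∀ d ≠ c, score r Γ d < score r Γ c := by
  constructor
  · rintro ⟨h, hu⟩ d hd
    by_contra! hlt
    exact hd (hu d fun e => (h e).trans hlt)
  · intro h
    refine ⟨fun d => ?_, fun d hd => ?_⟩
    · rcases eq_or_ne d c with rfl | hd
      · exact le_rfl
      · exact (h d hd).le
    · by_contra hne
      exact (h d hne).not_ge (hd c)

/-- Only votes that approve `p` need to be added. -/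
theorem isYes_iff : I.IsYes r ↔ ∃ l < I.R + 1, ∃ S ⊆ I.helpful r, S.card = l ∧
    ∀ d ≠ I.p, score r (I.V : Multiset (Ranking I.m)) d + I.gain r S d <
      score r (I.V : Multiset (Ranking I.m)) I.p + l := by
  constructor
  · rintro ⟨T', hT', hR, hw⟩
    obtain ⟨S, hS, rfl⟩ := (le_coe_iff_exists_finset I.T 1 T').1 hT'
    rw [isUniqueWinner_iff] at hw
    rw [Multiset.card_map] at hR
    -- Keep only the votes of `S` that approve `p`.
    refine ⟨I.gain r S I.p, ?_, {j ∈ S | ((I.unregistered j).symm I.p : ℕ) < r}, ?_, rfl, ?_⟩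
    · exact Nat.lt_succ_iff.2 ((Finset.card_le_card (Finset.filter_subset _ _)).trans hR)
    · exact Finset.filter_subset_filter _ hS
    · intro d hd
      have := hw d hd
      erw [I.score_add_map r S, I.score_add_map r S] at this
      refine lt_of_le_of_lt (Nat.add_le_add_left ?_ _) this
      exact Finset.card_le_card (Finset.filter_subset_filter _ (Finset.filter_subset _ _))
  · rintro ⟨l, hl, S, hS, hcard, h⟩
    refine ⟨S.val.map I.unregistered, ?_, ?_, ?_⟩
    · exact (le_coe_iff_exists_finset I.T 1 _).2 ⟨S, hS.trans (Finset.filter_subset _ _), rfl⟩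
    · rw [Multiset.card_map]
      have : S.val.card = l := hcard
      omega
    · rw [isUniqueWinner_iff]
      intro d hd
      rw [score_add_map, score_add_map]
      have : I.gain r S I.p = l := by
        rw [← hcard, gain, Finset.filter_true_of_mem]
        exact fun j hj => (Finset.mem_filter.1 (hS hj)).2
      rw [this]
      exact h d hd

end AVInstance

/-! ### The approved candidates of a 2-peaked vote -/

namespace Ranking

/-- Approved candidates in one block are less than `r` apart, as all candidates in between are
approved. -/
theorem lt_add_of_singlePeakedOn {m r : ℕ} {L π : Ranking m} {S : Set (Fin m)}
    (h : SinglePeakedOn L π S) {a c : Fin m} (hac : a ≤ c)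
    (hS : ∀ b, a ≤ b → b ≤ c → L b ∈ S) (ha : (π.symm (L a) : ℕ) < r)
    (hc : (π.symm (L c) : ℕ) < r) : (c : ℕ) < a + r := by
  have hb : ∀ b, a ≤ b → b ≤ c → (π.symm (L b) : ℕ) < r := by
    intro b hab hbc
    by_contra! hr
    have hab' : a < b := lt_of_le_of_ne hab fun h => by subst h; omega
    have hbc' : b < c := lt_of_le_of_ne hbc fun h => by subst h; omega
    -- An unapproved `b` strictly in between would rank below `c`; single-peakedness would then put
    -- it above the approved `a`.
    have := h (L a) (hS a le_rfl hac) (L b) (hS b hab hbc) (L c) (hS c hac le_rfl)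
      (Or.inl (by simp [Before, hab', hbc'])) (by
        simp only [Before, Fin.lt_def]
        omega)
    simp only [Before, Fin.lt_def] at this
    omega
  -- The interval from `a` to `c` injects into the top `r` positions of the vote.
  have := Finset.card_le_card_of_injOn (s := Finset.Icc a c) (t := Finset.range r)
    (fun b => (π.symm (L b) : ℕ)) (fun b hb' => by
      have := Finset.mem_Icc.1 hb'
      exact Finset.mem_coe.2 (Finset.mem_range.2 (hb b this.1 this.2)))
    (fun b _ b' _ hbb' => by simpa [Fin.val_inj] using hbb')
  rw [Fin.card_Icc, Finset.card_range] at this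
  omega

/-- If `p` is approved, then the approved candidates that are not near `p` lie in a short piece. -/
theorem KPeaked.lt_add_of_far {m r : ℕ} {L π : Ranking m} (h : KPeaked 2 L π) {p a c : Fin m}
    (hp : (π.symm (L p) : ℕ) < r) (ha : (π.symm (L a) : ℕ) < r) (hc : (π.symm (L c) : ℕ) < r)
    (hap : ¬ ((p : ℕ) ≤ a + r ∧ (a : ℕ) ≤ p + r)) (hcp : ¬ ((p : ℕ) ≤ c + r ∧ (c : ℕ) ≤ p + r)) :
    (c : ℕ) < a + r := by
  obtain ⟨block, hmono, hblock⟩ := h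
  have key : ∀ a c : Fin m, a ≤ c → (π.symm (L a) : ℕ) < r → (π.symm (L c) : ℕ) < r →
      block a = block c → (c : ℕ) < a + r := by
    intro a c hac ha hc hb
    refine lt_add_of_singlePeakedOn (hblock (block a)) hac (fun b h1 h2 => ?_) ha hc
    have h3 := hmono h1
    have h4 := hmono h2
    rw [← hb] at h4
    simpa using le_antisymm h4 h3
  have hne : ∀ a : Fin m, (π.symm (L a) : ℕ) < r → ¬ ((p : ℕ) ≤ a + r ∧ (a : ℕ) ≤ p + r) →
      block a ≠ block p := by
    intro a ha hap hb
    rcases le_total a p with h | h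
    · have := key a p h ha hp hb
      have : (a : ℕ) ≤ p := h
      omega
    · have := key p a h hp ha hb.symm
      have : (p : ℕ) ≤ a := h
      omega
  have h1 := hne a ha hap
  have h2 := hne c hc hcp
  rcases le_total a c with h | h
  -- Neither `a` nor `c` is in the block of `p`, and there are only two blocks.
  · exact key a c h ha hc (by omega)
  · have : (c : ℕ) ≤ a := h
    omega

end Ranking

/-! ### The selection problem read off from the input -/

namespace AVInput

open RAM

variable (r : ℕ) (x : List ℕ)

/-- The ranking number `u` of the input (the axis is number `0`, followed by the registered and the
unregistered votes) approves the candidate at the place `q` of the axis. -/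
def Approves (u q : ℕ) : Prop :=
  q < x.getD 0 0 ∧ ∃ i < r, i < x.getD 0 0 ∧
    x.getD (5 + u * x.getD 0 0 + i) 0 = x.getD (5 + q) 0

/-- The unregistered vote number `j` approves the candidate at the place `q`. -/
def AddApproves (j q : ℕ) : Prop := Approves r x (1 + x.getD 3 0 + j) q

open Classical in
/-- The place of the distinguished candidate. -/
noncomputable def place : ℕ :=
  ∑ q ∈ Finset.range (x.getD 0 0), if x.getD (5 + q) 0 = x.getD 1 0 then q else 0

/-- For a vote approving `p`, this range contains every approved candidate in the block of `p`. -/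
def Near (q : ℕ) : Prop := place x ≤ q + r ∧ q ≤ place x + r

open Classical in
/-- The number of registered votes that approve the candidate at the place `q`. -/
noncomputable def regScore (q : ℕ) : ℕ :=
  ∑ j ∈ Finset.range (x.getD 3 0), if Approves r x (1 + j) q then 1 else 0

def Far (j q : ℕ) : Prop := AddApproves r x j q ∧ ¬ Near r x q

/-- If `l` votes are added, then it is all right that `d` of them approve the candidate at the
place `q`. -/
def Admissible (l q d : ℕ) : Prop :=
  (q = place x → d = l) ∧ (q ≠ place x → regScore r x q + d < regScore r x (place x) + l)

open Classical in
/-- The problem of selecting `l` votes. -/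
noncomputable def data (l : ℕ) : SelectionData where
  B := x.getD 4 0 + 1
  r := r
  BX := (x.getD 4 0 + 1) ^ (2 * r + 1)
  -- The place of a vote is its last far approved candidate; votes with none are decided at `0`.
  At j a := AddApproves r x j (place x) ∧ (∀ q < x.getD 0 0, Far r x j q → q ≤ a) ∧
    (Far r x j a ∨ a = 0)
  far j q := if Far r x j q then 1 else 0
  -- Digit `i` stands for the place `place x + r - i`, so `2 * r + 1` digits cover all near places;
  -- digits that would lie before the start of the axis are `0`.
  xt j := digitSum (x.getD 4 0 + 1)
    (window (fun q => if AddApproves r x j q ∧ Near r x q then 1 else 0) (place x + r + 1))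
    (2 * r + 1)
  chk q d := Near r x q ∨ Admissible r x l q d
  fin X := ∀ i < 2 * r + 1, i < place x + r + 1 → place x + r - i < x.getD 0 0 →
    Admissible r x l (place x + r - i) (X / (x.getD 4 0 + 1) ^ i % (x.getD 4 0 + 1))

/-- The place of a state in the table: `k` steps to go, `l` votes to be added, with the sum `X` and
the loads `W`. -/
def code (k l X W : ℕ) : ℕ :=
  ((k * (x.getD 4 0 + 1) + l) * (x.getD 4 0 + 1) ^ (2 * r + 1) + X) * (x.getD 4 0 + 1) ^ r + W

/-- The recursion of `SelectionData.Feas`, with references to a table. -/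
def Step (tab : ℕ → ℕ) (k l X W : ℕ) : Prop :=
  (k = 0 ∧ (data r x l).fin X) ∨
  (0 < k ∧
    (((k - 1) % (x.getD 4 0 + 1) = 0 ∧
      (data r x l).chk ((k - 1) / (x.getD 4 0 + 1)) (W % (x.getD 4 0 + 1)) ∧
        0 < tab (code r x (k - 1) l X (W / (x.getD 4 0 + 1)))) ∨
    ((k - 1) % (x.getD 4 0 + 1) ≠ 0 ∧
      (0 < tab (code r x (k - 1) l X W) ∨
        ((data r x l).At ((k - 1) % (x.getD 4 0 + 1) - 1) ((k - 1) / (x.getD 4 0 + 1)) ∧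
        X + (data r x l).xt ((k - 1) % (x.getD 4 0 + 1) - 1) < (x.getD 4 0 + 1) ^ (2 * r + 1) ∧
        W + (data r x l).wt ((k - 1) % (x.getD 4 0 + 1) - 1) ((k - 1) / (x.getD 4 0 + 1)) <
          (x.getD 4 0 + 1) ^ r ∧
        0 < tab (code r x (k - 1) l (X + (data r x l).xt ((k - 1) % (x.getD 4 0 + 1) - 1))
          (W + (data r x l).wt ((k - 1) % (x.getD 4 0 + 1) - 1)
            ((k - 1) / (x.getD 4 0 + 1)))))))))

/-! ### Terms for the selection problem -/

section Terms

variable {r} {u q a k l X W : Ctx → ℕ}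

theorem isTermPred_approves (hu : IsTerm u) (hq : IsTerm q) :
    IsTermPred fun c => Approves r c.x (u c) (q c) :=
  .and (.lt hq (.read (.const 0)))
    (.exists_lt (P := fun c i => i < c.x.getD 0 0 ∧
        c.x.getD (5 + u c * c.x.getD 0 0 + i) 0 = c.x.getD (5 + q c) 0) (.const r)
      (.and (.lt .top (.read (.const 0)))
        (.eq (.read (((IsTerm.const 5).add (hu.pop.mul (.read (.const 0)))).add .top))
          (.read ((IsTerm.const 5).add hq.pop)))))

theorem isTermPred_addApproves (hu : IsTerm u) (hq : IsTerm q) :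
    IsTermPred fun c => AddApproves r c.x (u c) (q c) :=
  isTermPred_approves (((IsTerm.const 1).add (.read (.const 3))).add hu) hq

theorem isTerm_place : IsTerm fun c => place c.x := by
  classical
  exact .sum (.read (.const 0)) (.ite (.eq (.read ((IsTerm.const 5).add .top))
    (.read (.const 1))) .top (.const 0))

theorem isTermPred_near (hq : IsTerm q) : IsTermPred fun c => Near r c.x (q c) :=
  .and (.le isTerm_place (hq.add (.const r))) (.le hq (isTerm_place.add (.const r)))

theorem isTerm_regScore (hq : IsTerm q) : IsTerm fun c => regScore r c.x (q c) := by
  classical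
  exact .sum (F := fun c j => if Approves r c.x (1 + j) (q c) then 1 else 0) (.read (.const 3))
    (.indicator (isTermPred_approves (u := fun c => 1 + c.top) ((IsTerm.const 1).add .top) hq.pop))

theorem isTermPred_far (hu : IsTerm u) (hq : IsTerm q) :
    IsTermPred fun c => Far r c.x (u c) (q c) :=
  .and (isTermPred_addApproves hu hq) (isTermPred_near hq).not

theorem isTermPred_admissible {d : Ctx → ℕ} (hl : IsTerm l) (hq : IsTerm q) (hd : IsTerm d) :
    IsTermPred fun c => Admissible r c.x (l c) (q c) (d c) :=
  .and (.imp (.eq hq isTerm_place) (.eq hd hl))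
    (.imp (.ne hq isTerm_place)
      (.lt ((isTerm_regScore hq).add hd) ((isTerm_regScore isTerm_place).add hl)))

theorem isTerm_base : IsTerm fun c => c.x.getD 4 0 + 1 :=
  .add (.read (.const 4)) (.const 1)

theorem isTerm_digitSum_window {b A : Ctx → ℕ} {F : Ctx → ℕ → ℕ} (hb : IsTerm b) (hA : IsTerm A)
    (hF : ∀ {q : Ctx → ℕ}, IsTerm q → IsTerm fun c => F c (q c)) (n : ℕ) :
    IsTerm fun c => digitSum (b c) (window (F c) (A c)) n :=
  .sum_range n fun i => .mul
    (.ite (.lt (.const i) hA) (hF ((hA.sub (.const 1)).sub (.const i))) (.const 0)) (hb.pow i)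

theorem isTerm_xt (hu : IsTerm u) : IsTerm fun c => (data r c.x (l c)).xt (u c) := by
  classical
  exact isTerm_digitSum_window
    (F := fun c q => if AddApproves r c.x (u c) q ∧ Near r c.x q then 1 else 0) isTerm_base
    ((isTerm_place.add (.const r)).add (.const 1))
    (fun hq => .indicator (.and (isTermPred_addApproves hu hq) (isTermPred_near hq))) _

theorem isTerm_wt (hu : IsTerm u) (ha : IsTerm a) :
    IsTerm fun c => (data r c.x (l c)).wt (u c) (a c) := by
  classical
  exact isTerm_digitSum_window (F := fun c q => if Far r c.x (u c) q then 1 else 0) isTerm_base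
    (ha.add (.const 1)) (fun hq => .indicator (isTermPred_far hu hq)) _

theorem isTermPred_at (hu : IsTerm u) (ha : IsTerm a) :
    IsTermPred fun c => (data r c.x (l c)).At (u c) (a c) :=
  .and (isTermPred_addApproves hu isTerm_place)
    (.and (.forall_lt (P := fun c q => Far r c.x (u c) q → q ≤ a c) (.read (.const 0))
        (.imp (isTermPred_far (u := fun c => u c.pop) hu.pop .top) (.le .top ha.pop)))
      (.or (isTermPred_far hu ha) (.eq ha (.const 0))))

theorem isTermPred_chk {d : Ctx → ℕ} (hl : IsTerm l) (hq : IsTerm q) (hd : IsTerm d) :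
    IsTermPred fun c => (data r c.x (l c)).chk (q c) (d c) :=
  .or (isTermPred_near hq) (isTermPred_admissible hl hq hd)

/-- The conjunction is unrolled because the predicates involve powers with exponent `i`, which are
terms only for fixed `i`. -/
theorem isTermPred_forall_static {P : Ctx → ℕ → Prop} (hP : ∀ i, IsTermPred fun c => P c i)
    (n : ℕ) : IsTermPred fun c => ∀ i < n, P c i := by
  induction n with
  | zero => exact (IsTermPred.eq (.const 0) (.const 0)).congr fun c => by simp
  | succ n ih => exact (ih.and (hP n)).congr fun c => by rw [Nat.forall_lt_succ_right]

theorem isTermPred_fin (hl : IsTerm l) (hX : IsTerm X) :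
    IsTermPred fun c => (data r c.x (l c)).fin (X c) :=
  isTermPred_forall_static (fun i =>
    .imp (.lt (.const i) ((isTerm_place.add (.const r)).add (.const 1)))
      (.imp (.lt ((isTerm_place.add (.const r)).sub (.const i)) (.read (.const 0)))
        (isTermPred_admissible hl ((isTerm_place.add (.const r)).sub (.const i))
          ((hX.div (isTerm_base.pow i)).mod isTerm_base)))) _

theorem isTerm_code (hk : IsTerm k) (hl : IsTerm l) (hX : IsTerm X) (hW : IsTerm W) :
    IsTerm fun c => code r c.x (k c) (l c) (X c) (W c) :=
  ((((hk.mul isTerm_base).add hl).mul (isTerm_base.pow _)).add hX).mul (isTerm_base.pow _)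
    |>.add hW

theorem isTermPred_step (hk : IsTerm k) (hl : IsTerm l) (hX : IsTerm X) (hW : IsTerm W) :
    IsTermPred fun c => Step r c.x c.tab (k c) (l c) (X c) (W c) := by
  have hk' := hk.sub (.const 1)
  have hm := hk'.mod isTerm_base
  have hd := hk'.div isTerm_base
  have hj := hm.sub (.const 1)
  have hX' := hX.add (isTerm_xt (r := r) (l := l) hj)
  have hW' := hW.add (isTerm_wt (r := r) (l := l) hj hd)
  exact .or (.and (.eq hk (.const 0)) (isTermPred_fin hl hX))
    (.and (.lt (.const 0) hk)
      (.or (.and (.eq hm (.const 0)) (.and (isTermPred_chk hl hd (hW.mod isTerm_base))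
          (.lt (.const 0) (.tab (isTerm_code hk' hl hX (hW.div isTerm_base))))))
        (.and (.ne hm (.const 0)) (.or (.lt (.const 0) (.tab (isTerm_code hk' hl hX hW)))
          (.and (isTermPred_at hj hd) (.and (.lt hX' (isTerm_base.pow _))
            (.and (.lt hW' (isTerm_base.pow _))
              (.lt (.const 0) (.tab (isTerm_code hk' hl hX' hW'))))))))))

end Terms

end AVInput

namespace AVInput

open RAM

/-! ### The table -/

section Table

variable (r : ℕ) (x : List ℕ)

/-- The entry of the table at the place `v`. -/
def Entry (v : ℕ) : Prop :=
  (data r x (v / (x.getD 4 0 + 1) ^ r / (x.getD 4 0 + 1) ^ (2 * r + 1) % (x.getD 4 0 + 1))).Feas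
    (v / (x.getD 4 0 + 1) ^ r / (x.getD 4 0 + 1) ^ (2 * r + 1) / (x.getD 4 0 + 1))
    (v / (x.getD 4 0 + 1) ^ r % (x.getD 4 0 + 1) ^ (2 * r + 1))
    (v % (x.getD 4 0 + 1) ^ r)

variable {r x}

/-- The code is a mixed-radix number, so its components can be recovered when all but the leading
one `k` are below their bases. The size guards in `SelectionData.Feas` serve this purpose. -/
theorem entry_code {k l X W : ℕ} (hl : l < x.getD 4 0 + 1)
    (hX : X < (x.getD 4 0 + 1) ^ (2 * r + 1)) (hW : W < (x.getD 4 0 + 1) ^ r) :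
    Entry r x (code r x k l X W) ↔ (data r x l).Feas k X W := by
  have digit : ∀ {a b c : ℕ}, c < b → (a * b + c) / b = a ∧ (a * b + c) % b = c := by
    intro a b c h
    rw [mul_comm, Nat.mul_add_div (by omega), Nat.div_eq_of_lt h, Nat.mul_add_mod,
      Nat.mod_eq_of_lt h]
    exact ⟨rfl, rfl⟩
  unfold Entry code
  rw [(digit hW).1, (digit hW).2, (digit hX).1, (digit hX).2, (digit hl).1, (digit hl).2]

/-- As `k` is the leading component, states with fewer steps to go come earlier in the table,
whatever their other components. -/
theorem code_lt_code {k k' l X W v : ℕ} (hk : k < k') (hl : l < x.getD 4 0 + 1)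
    (hX : X < (x.getD 4 0 + 1) ^ (2 * r + 1)) (hW : W < (x.getD 4 0 + 1) ^ r)
    (hv : k' ≤ v / (x.getD 4 0 + 1) ^ r / (x.getD 4 0 + 1) ^ (2 * r + 1) / (x.getD 4 0 + 1)) :
    code r x k l X W < v := by
  have lift : ∀ {a b c d : ℕ}, c < b → a < d / b → a * b + c < d := by
    intro a b c d hc had
    have h1 := Nat.mul_le_mul_right b had
    have h2 := Nat.div_mul_le_self d b
    rw [Nat.succ_mul] at h1
    omega
  exact lift hW (lift hX (lift hl (hk.trans_le hv)))

/-- One step of the recursion refers only to states with one step less to go, whose entries are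
already correct. -/
theorem step_iff_entry (v : ℕ) (tab : ℕ → ℕ) (htab : ∀ u < v, 0 < tab u ↔ Entry r x u) :
    Step r x tab
      (v / (x.getD 4 0 + 1) ^ r / (x.getD 4 0 + 1) ^ (2 * r + 1) / (x.getD 4 0 + 1))
      (v / (x.getD 4 0 + 1) ^ r / (x.getD 4 0 + 1) ^ (2 * r + 1) % (x.getD 4 0 + 1))
      (v / (x.getD 4 0 + 1) ^ r % (x.getD 4 0 + 1) ^ (2 * r + 1))
      (v % (x.getD 4 0 + 1) ^ r) ↔ Entry r x v := by
  have hB : 0 < x.getD 4 0 + 1 := Nat.succ_pos _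
  unfold Entry
  have hX := Nat.mod_lt (v / (x.getD 4 0 + 1) ^ r) (Nat.pow_pos (n := 2 * r + 1) hB)
  have hW := Nat.mod_lt v (Nat.pow_pos (n := r) hB)
  have hl := Nat.mod_lt (v / (x.getD 4 0 + 1) ^ r / (x.getD 4 0 + 1) ^ (2 * r + 1)) hB
  have hk := le_refl (v / (x.getD 4 0 + 1) ^ r / (x.getD 4 0 + 1) ^ (2 * r + 1) /
    (x.getD 4 0 + 1))
  generalize hk' : v / (x.getD 4 0 + 1) ^ r / (x.getD 4 0 + 1) ^ (2 * r + 1) /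
    (x.getD 4 0 + 1) = k at hk ⊢
  have hkv : k ≤ v / (x.getD 4 0 + 1) ^ r / (x.getD 4 0 + 1) ^ (2 * r + 1) /
    (x.getD 4 0 + 1) := hk'.ge
  generalize v / (x.getD 4 0 + 1) ^ r / (x.getD 4 0 + 1) ^ (2 * r + 1) % (x.getD 4 0 + 1) = l at *
  generalize v / (x.getD 4 0 + 1) ^ r % (x.getD 4 0 + 1) ^ (2 * r + 1) = X at *
  generalize v % (x.getD 4 0 + 1) ^ r = W at *
  cases k with
  | zero => simp [Step, SelectionData.Feas]
  | succ k =>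
    have ref : ∀ {X W : ℕ}, X < (x.getD 4 0 + 1) ^ (2 * r + 1) → W < (x.getD 4 0 + 1) ^ r →
        (0 < tab (code r x k l X W) ↔ (data r x l).Feas k X W) := by
      intro X W hX hW
      rw [htab _ (code_lt_code (Nat.lt_succ_self k) hl hX hW hkv), entry_code hl hX hW]
    unfold Step SelectionData.Feas
    simp only [Nat.add_sub_cancel]
    rw [ref hX hW, ref hX ((Nat.div_le_self _ _).trans_lt hW)]
    refine ⟨?_, fun h => Or.inr ⟨Nat.succ_pos k, ?_⟩⟩
    · rintro (⟨h, -⟩ | ⟨-, h | ⟨hm, h | ⟨h1, h2, h3, h4⟩⟩⟩)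
      · omega
      · exact Or.inl h
      · exact Or.inr ⟨hm, Or.inl h⟩
      · exact Or.inr ⟨hm, Or.inr ⟨h1, h2, h3, (ref h2 h3).1 h4⟩⟩
    · rcases h with h | ⟨hm, h | ⟨h1, h2, h3, h4⟩⟩
      · exact Or.inl h
      · exact Or.inr ⟨hm, Or.inl h⟩
      · exact Or.inr ⟨hm, Or.inr ⟨h1, h2, h3, (ref h2 h3).2 h4⟩⟩

/-- A problem is solvable in polynomial time if it is the question whether `l` votes can be
selected for some `l` in the bound given. -/
theorem polyTimeSolvable_of_feas {α : Type} {encode : α → List ℕ} {Yes : α → Prop}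
    (hN : ∀ I, ∀ v ∈ encode I, v ≤ inputLength (encode I))
    (hR : ∀ I, (encode I).getD 2 0 ≤ (encode I).getD 4 0)
    (h : ∀ I, Yes I ↔ ∃ l < (encode I).getD 2 0 + 1, (data r (encode I) l).Feas
      ((encode I).getD 0 0 * ((encode I).getD 4 0 + 1)) 0 0) :
    PolyTimeSolvable encode Yes := by
  classical
  have hk : IsTerm fun c => c.x.getD 0 0 * (c.x.getD 4 0 + 1) :=
    (IsTerm.read (.const 0)).mul isTerm_base
  -- The table ends at the first code with `m * B + 1` steps to go, where `B` is the number of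
  -- unregistered votes plus one.
  obtain ⟨size, hsize⟩ := isTerm_code (r := r) (hk.add (.const 1)) (.const 0) (.const 0) (.const 0)
  have hv := (IsTerm.top.div (isTerm_base.pow r)).div (isTerm_base.pow (2 * r + 1))
  obtain ⟨φ, hφ⟩ := IsTerm.indicator (isTermPred_step (r := r) (hv.div isTerm_base)
    (hv.mod isTerm_base) ((IsTerm.top.div (isTerm_base.pow r)).mod (isTerm_base.pow (2 * r + 1)))
    (IsTerm.top.mod (isTerm_base.pow r)))
  obtain ⟨ψ, hψ⟩ := IsTerm.indicator (IsTermPred.exists_lt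
    (P := fun c l => 0 < c.tab (code r c.x (c.x.getD 0 0 * (c.x.getD 4 0 + 1)) l 0 0))
    ((IsTerm.read (.const 2)).add (.const 1))
    (.lt (.const 0) (.tab (isTerm_code hk.pop .top (.const 0) (.const 0)))))
  refine polyTimeSolvable_of_terms size φ ψ (fun I v => if Entry r (encode I) v then 1 else 0) hN
    (fun I v => by split_ifs <;> omega) (fun I v tab _ htab => ?_) (fun I tab htab => ?_)
  · rw [hφ]
    refine if_congr (step_iff_entry v tab fun u hu => ?_) rfl rfl
    rw [htab u hu]
    split_ifs <;> simp_all
  · rw [hψ, h]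
    have : ∀ l < (encode I).getD 2 0 + 1,
        (0 < tab (code r (encode I) ((encode I).getD 0 0 * ((encode I).getD 4 0 + 1)) l 0 0) ↔
        (data r (encode I) l).Feas ((encode I).getD 0 0 * ((encode I).getD 4 0 + 1)) 0 0) := by
      intro l hl
      have hl' : l < (encode I).getD 4 0 + 1 := hl.trans_le (Nat.succ_le_succ (hR I))
      have hB : 0 < (encode I).getD 4 0 + 1 := Nat.succ_pos _
      have hX := Nat.pow_pos (n := 2 * r + 1) hB
      have hW := Nat.pow_pos (n := r) hB
      rw [htab]
      · rw [← entry_code hl' hX hW]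
        split_ifs <;> simp_all
      · rw [hsize]
        unfold code
        simp only [add_zero]
        refine Nat.mul_lt_mul_of_pos_right (Nat.mul_lt_mul_of_pos_right ?_ hX) hW
        rw [Nat.succ_mul]
        omega
    simp only [ne_eq, ite_eq_right_iff, one_ne_zero, imp_false, not_not]
    exact exists_congr fun l => and_congr_right fun hl => this l hl

end Table

end AVInput

/-! ### Reading an instance -/

theorem List.getD_flatMap_of_length {α : Type*} (f : α → List ℕ) (m : ℕ) (d : α) :
    ∀ (l : List α), (∀ a ∈ l, (f a).length = m) → ∀ u < l.length, ∀ i < m,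
      (l.flatMap f).getD (u * m + i) 0 = (f (l.getD u d)).getD i 0
  | [], _, u, hu, _, _ => absurd hu (Nat.not_lt_zero u)
  | a :: l, h, u, hu, i, hi => by
    rw [List.flatMap_cons]
    have ha := h a (List.mem_cons_self ..)
    cases u with
    | zero =>
      rw [List.getD_append _ _ _ _ (by omega)]
      simp
    | succ u =>
      have hle : (f a).length ≤ (u + 1) * m + i := by
        rw [ha, Nat.succ_mul]
        omega
      rw [List.getD_append_right _ _ _ _ hle, ha,
        show (u + 1) * m + i - m = u * m + i by rw [Nat.succ_mul]; omega, List.getD_cons_succ]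
      exact getD_flatMap_of_length f m d l (fun b hb => h b (List.mem_cons_of_mem a hb)) u
        (by simpa using hu) i hi

namespace AVInstance

open RAM AVInput

variable {k : ℕ} (r : ℕ) (I : AVInstance k)

theorem encode_getD (u : ℕ) (hu : u < 1 + I.V.length + I.T.length) (i : ℕ) (hi : i < I.m) :
    I.encode.getD (5 + u * I.m + i) 0 = ((I.L :: (I.V ++ I.T)).getD u 1) ⟨i, hi⟩ := by
  have h1 : I.encode = [I.m, (I.p : ℕ), I.R, I.V.length, I.T.length] ++
      (I.L :: (I.V ++ I.T)).flatMap Ranking.toList := by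
    simp [encode]
  rw [h1, List.getD_append_right _ _ _ _ (by simp; omega)]
  rw [show 5 + u * I.m + i - [I.m, (I.p : ℕ), I.R, I.V.length, I.T.length].length =
    u * I.m + i by simp; omega,
    List.getD_flatMap_of_length Ranking.toList I.m 1 _ (by simp [Ranking.toList]) u
      (by simp; omega) i hi]
  simp [Ranking.toList, hi]

theorem encode_getD_axis (q : ℕ) (hq : q < I.m) : I.encode.getD (5 + q) 0 = I.L ⟨q, hq⟩ := by
  simpa using I.encode_getD 0 (by omega) q hq

theorem approves_iff (u : ℕ) (hu : u < 1 + I.V.length + I.T.length) (q : ℕ) :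
    Approves r I.encode u q ↔ ∃ hq : q < I.m,
      (((I.L :: (I.V ++ I.T)).getD u 1).symm (I.L ⟨q, hq⟩) : ℕ) < r := by
  have h0 : I.encode.getD 0 0 = I.m := rfl
  unfold Approves
  rw [h0]
  set π : Ranking I.m := (I.L :: (I.V ++ I.T)).getD u 1 with hπ
  constructor
  · rintro ⟨hq, i, hir, him, h⟩
    rw [I.encode_getD u hu i him, I.encode_getD_axis q hq, Fin.val_inj] at h
    refine ⟨hq, ?_⟩
    rw [← h, ← hπ, Equiv.symm_apply_apply]
    exact hir
  · rintro ⟨hq, h⟩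
    refine ⟨hq, _, h, (π.symm (I.L ⟨q, hq⟩)).2, ?_⟩
    rw [I.encode_getD u hu _ (π.symm (I.L ⟨q, hq⟩)).2, I.encode_getD_axis q hq, ← hπ]
    simp

theorem addApproves_iff (j : ℕ) (hj : j < I.T.length) (q : ℕ) :
    AddApproves r I.encode j q ↔ ∃ hq : q < I.m,
      ((I.unregistered j).symm (I.L ⟨q, hq⟩) : ℕ) < r := by
  have h3 : I.encode.getD 3 0 = I.V.length := rfl
  unfold AddApproves
  rw [h3, I.approves_iff r _ (by omega)]
  have : (I.L :: (I.V ++ I.T)).getD (1 + I.V.length + j) 1 = I.unregistered j := by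
    rw [show 1 + I.V.length + j = (I.V.length + j) + 1 by omega, List.getD_cons_succ,
      List.getD_append_right _ _ _ _ (by omega), Nat.add_sub_cancel_left]
    rfl
  rw [this]

theorem place_encode : place I.encode = (I.L.symm I.p : ℕ) := by
  classical
  have h0 : I.encode.getD 0 0 = I.m := rfl
  have h1 : I.encode.getD 1 0 = I.p := rfl
  unfold place
  rw [h0, h1, Finset.sum_eq_single (I.L.symm I.p : ℕ)]
  · rw [I.encode_getD_axis _ (I.L.symm I.p).2]
    simp
  · intro q hq hne
    rw [I.encode_getD_axis q (Finset.mem_range.1 hq), if_neg]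
    intro h
    apply hne
    rw [← Fin.val_inj.1 h, Equiv.symm_apply_apply]
  · intro h
    exact absurd (Finset.mem_range.2 (I.L.symm I.p).2) h

theorem regScore_encode (q : ℕ) (hq : q < I.m) :
    regScore r I.encode q = score r (I.V : Multiset (Ranking I.m)) (I.L ⟨q, hq⟩) := by
  classical
  have h3 : I.encode.getD 3 0 = I.V.length := rfl
  unfold regScore score
  rw [h3, coe_eq_map_getD I.V 1, Multiset.countP_map, ← Finset.card_filter]
  change _ = (Finset.filter _ (Finset.range I.V.length)).card
  congr 1
  refine Finset.filter_congr fun j hj => ?_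
  have hj' := Finset.mem_range.1 hj
  rw [I.approves_iff r _ (by omega)]
  have : (I.L :: (I.V ++ I.T)).getD (1 + j) 1 = I.V.getD j 1 := by
    rw [add_comm, List.getD_cons_succ, List.getD_append _ _ _ _ hj']
  rw [this]
  simp [hq]

/-- The rankings are written out and each has at least one entry, so the numbers in the header are
bounded by the number of entries of the input, not merely by an exponential in its bit length. -/
theorem le_inputLength (v : ℕ) (hv : v ∈ I.encode) : v ≤ inputLength I.encode := by
  have h1 : I.encode.length ≤ inputLength I.encode := by
    unfold inputLength
    induction I.encode with
    | nil => simp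
    | cons a l ih =>
      simp only [List.length_cons, List.map_cons, List.sum_cons]
      omega
  refine le_trans ?_ h1
  have hm : 0 < I.m := (Nat.zero_le _).trans_lt I.p.2
  have h2 : I.encode.length = 5 + (I.m + (I.V.length * I.m + I.T.length * I.m)) := by
    simp [encode, Ranking.toList, List.length_flatMap]
    omega
  have h3 := Nat.le_mul_of_pos_right I.V.length hm
  have h4 := Nat.le_mul_of_pos_right I.T.length hm
  have h5 := I.R_le
  have h6 := I.p.2
  have h7 : ∀ π : Ranking I.m, v ∈ π.toList → v < I.m := by
    intro π h
    obtain ⟨i, rfl⟩ := List.mem_ofFn.1 h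
    exact (π i).2
  simp only [encode, List.mem_append, List.mem_cons, List.not_mem_nil, or_false,
    List.mem_flatMap] at hv
  rcases hv with (h | h | h | h | h) | h | ⟨π, -, h⟩ | ⟨π, -, h⟩
  on_goal 6 => have := h7 _ h
  on_goal 7 => have := h7 _ h
  on_goal 8 => have := h7 _ h
  all_goals omega

end AVInstance

theorem Finset.sup_id_eq_iff {F : Finset ℕ} {a : ℕ} :
    F.sup id = a ↔ (∀ q ∈ F, q ≤ a) ∧ (a ∈ F ∨ a = 0) := by
  constructor
  · rintro rfl
    refine ⟨fun q hq => Finset.le_sup (f := id) hq, ?_⟩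
    rcases F.eq_empty_or_nonempty with rfl | h
    · exact Or.inr rfl
    · obtain ⟨b, hb, hb'⟩ := Finset.exists_mem_eq_sup F h id
      exact Or.inl (hb' ▸ hb)
  · rintro ⟨h, h'⟩
    refine le_antisymm (Finset.sup_le h) ?_
    rcases h' with h' | rfl
    · exact Finset.le_sup (f := id) h'
    · exact Nat.zero_le _

/-! ### Unregistered votes as items with short windows. -/

namespace AVInstance

open RAM AVInput

open Classical in
/-- The last approved candidate far from `p` of an unregistered vote. -/
noncomputable def lastFar {k : ℕ} (r : ℕ) (I : AVInstance k) (j : ℕ) : ℕ :=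
  {q ∈ Finset.range I.m | Far r I.encode j q}.sup id

section

variable {k : ℕ} (r : ℕ) (I : AVInstance k)

theorem mem_helpful {j : ℕ} : j ∈ I.helpful r ↔
    j < I.T.length ∧ AddApproves r I.encode j (place I.encode) := by
  simp only [helpful, Finset.mem_filter, Finset.mem_range]
  refine and_congr_right fun hj => ?_
  rw [I.addApproves_iff r j hj, place_encode]
  simp

theorem lastFar_eq_iff {j a : ℕ} (ha : a < I.m) : I.lastFar r j = a ↔
    (∀ q < I.m, Far r I.encode j q → q ≤ a) ∧ (Far r I.encode j a ∨ a = 0) := by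
  simp [lastFar, Finset.sup_id_eq_iff, ha]

theorem lastFar_lt (j : ℕ) : I.lastFar r j < I.m := by
  classical
  refine (Finset.sup_lt_iff ((Nat.zero_le _).trans_lt I.p.2)).2 fun q hq => ?_
  exact Finset.mem_range.1 (Finset.mem_filter.1 hq).1

open Classical in
theorem sum_approves {S : Finset ℕ} (hS : S ⊆ I.helpful r) {q : ℕ} (hq : q < I.m) :
    (∑ j ∈ S, if AddApproves r I.encode j q then 1 else 0) = I.gain r S (I.L ⟨q, hq⟩) := by
  rw [← Finset.card_filter, gain]
  congr 1
  refine Finset.filter_congr fun j hj => ?_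
  rw [I.addApproves_iff r j ((I.mem_helpful r).1 (hS hj)).1]
  simp [hq]

theorem gain_p {S : Finset ℕ} (hS : S ⊆ I.helpful r) : I.gain r S I.p = S.card := by
  rw [gain, Finset.filter_true_of_mem]
  exact fun j hj => (Finset.mem_filter.1 (hS hj)).2

theorem card_le_of_subset_helpful {S : Finset ℕ} (hS : S ⊆ I.helpful r) :
    S.card ≤ I.T.length := by
  simpa using Finset.card_le_card (hS.trans (Finset.filter_subset _ _))

open Classical in
theorem sum_xt (l : ℕ) (S : Finset ℕ) : ∑ j ∈ S, (data r I.encode l).xt j =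
    digitSum (I.T.length + 1) (window (fun q => ∑ j ∈ S,
      if AddApproves r I.encode j q ∧ Near r I.encode q then 1 else 0)
        (place I.encode + r + 1)) (2 * r + 1) := by
  change ∑ j ∈ S, digitSum _ _ _ = _
  rw [← digitSum_sum]
  congr 1
  funext i
  rw [window_sum]

open Classical in
theorem sum_near_lt {S : Finset ℕ} (hS : S ⊆ I.helpful r) (q : ℕ) :
    (∑ j ∈ S, if AddApproves r I.encode j q ∧ Near r I.encode q then 1 else 0) <
      I.T.length + 1 := by
  rw [← Finset.card_filter]
  exact Nat.lt_succ_iff.2 ((Finset.card_le_card (Finset.filter_subset _ _)).trans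
    (I.card_le_of_subset_helpful r hS))

/-- At the place of `p`, where every vote of `S` contributes, admissibility says that `S` has `l`
elements; at the other places it says that `p` stays strictly ahead. -/
theorem forall_admissible_iff (l : ℕ) {S : Finset ℕ} (hS : S ⊆ I.helpful r) :
    (∀ q (hq : q < I.m), Admissible r I.encode l q (I.gain r S (I.L ⟨q, hq⟩))) ↔
      S.card = l ∧ ∀ d ≠ I.p, score r (I.V : Multiset (Ranking I.m)) d + I.gain r S d <
        score r (I.V : Multiset (Ranking I.m)) I.p + l := by
  have hp := I.place_encode
  have hpm : place I.encode < I.m := hp ▸ (I.L.symm I.p).2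
  have hLp : I.L ⟨place I.encode, hpm⟩ = I.p := by
    rw [← I.L.apply_symm_apply I.p]
    congr 1
    exact Fin.ext hp
  constructor
  · intro h
    refine ⟨?_, fun d hd => ?_⟩
    · rw [← (h _ hpm).1 rfl, hLp, I.gain_p r hS]
    · have hne : (I.L.symm d : ℕ) ≠ place I.encode := by
        rw [hp]
        intro h
        exact hd (I.L.symm.injective (Fin.ext h))
      have := (h _ (I.L.symm d).2).2 hne
      rw [I.regScore_encode r _ (I.L.symm d).2, I.regScore_encode r _ hpm, hLp] at this
      simpa using this
  · rintro ⟨hc, h⟩ q hq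
    constructor
    · rintro rfl
      rw [hLp, I.gain_p r hS, hc]
    · intro hne
      rw [I.regScore_encode r _ hq, I.regScore_encode r _ hpm, hLp]
      refine h _ fun he => hne ?_
      rw [hp, ← he]
      simp

/-- The checks of the selection problem say that all gains are admissible. -/
theorem fin_and_chk_iff (l : ℕ) {S : Finset ℕ} (hS : S ⊆ I.helpful r) :
    ((data r I.encode l).fin (∑ j ∈ S, (data r I.encode l).xt j) ∧
      ∀ q < I.m, (data r I.encode l).chk q ((data r I.encode l).load S q)) ↔
    ∀ q (hq : q < I.m), Admissible r I.encode l q (I.gain r S (I.L ⟨q, hq⟩)) := by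
  classical
  have hload : ∀ q (hq : q < I.m), ¬ Near r I.encode q →
      (data r I.encode l).load S q = I.gain r S (I.L ⟨q, hq⟩) := by
    intro q hq hn
    rw [← I.sum_approves r hS hq]
    refine Finset.sum_congr rfl fun j _ => ?_
    simp [data, Far, hn]
  -- The number collected from the items stores the gains at the near places digit by digit, with no
  -- carries.
  have hdigit : ∀ q (hq : q < I.m), Near r I.encode q →
      (∑ j ∈ S, (data r I.encode l).xt j) / (I.T.length + 1) ^ (place I.encode + r - q) %
        (I.T.length + 1) = I.gain r S (I.L ⟨q, hq⟩) := by
    intro q hq hn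
    rw [I.sum_xt, digitSum_digit (fun i => window_lt (I.sum_near_lt r hS) _ i)
      (by have := hn.1; omega), window, if_pos (by omega),
      show place I.encode + r + 1 - 1 - (place I.encode + r - q) = q by have := hn.2; omega,
      ← I.sum_approves r hS hq]
    simp [hn]
  constructor
  · rintro ⟨hfin, hchk⟩ q hq
    by_cases hn : Near r I.encode q
    · rw [← hdigit q hq hn]
      have hq' : place I.encode + r - (place I.encode + r - q) = q := by
        have := hn.2
        omega
      have := hfin (place I.encode + r - q) (by have := hn.1; omega) (by omega)
        (by rw [hq']; exact hq)
      rw [hq'] at this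
      exact this
    · rw [← hload q hq hn]
      exact (hchk q hq).resolve_left hn
  · intro h
    constructor
    · intro i hi hi' hm
      have hn : Near r I.encode (place I.encode + r - i) := ⟨by omega, by omega⟩
      have := h _ hm
      rw [← hdigit _ hm hn] at this
      rw [show place I.encode + r - (place I.encode + r - i) = i by omega] at this
      exact this
    · intro q hq
      by_cases hn : Near r I.encode q
      · exact Or.inl hn
      · right
        rw [hload q hq hn]
        exact h q hq

end

variable (r : ℕ) (I : AVInstance 2)

/-- Here 2-peakedness enters: all far approved candidates of a helpful vote fit into one window of
`r` places. The default `lastFar = 0` is harmless because an approval forces `0 < r`. -/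
theorem lastFar_lt_add {j q : ℕ} (hj : j ∈ I.helpful r) (hq : Far r I.encode j q) :
    I.lastFar r j < q + r := by
  obtain ⟨hjT, hp⟩ := (I.mem_helpful r).1 hj
  have hpeak : Ranking.KPeaked 2 I.L (I.unregistered j) := by
    refine I.peaked_T _ ?_
    rw [unregistered, List.getD_eq_getElem _ _ hjT]
    exact List.getElem_mem _
  obtain ⟨h1, h2⟩ := (I.lastFar_eq_iff r (I.lastFar_lt r j)).1 rfl
  rcases h2 with h2 | h2
  · obtain ⟨hpm, hp⟩ := (I.addApproves_iff r j hjT _).1 hp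
    obtain ⟨hqm, ha⟩ := (I.addApproves_iff r j hjT _).1 hq.1
    obtain ⟨hbm, hb⟩ := (I.addApproves_iff r j hjT _).1 h2.1
    exact hpeak.lt_add_of_far hp ha hb hq.2 h2.2
  · obtain ⟨hqm, ha⟩ := (I.addApproves_iff r j hjT _).1 hq.1
    omega

theorem located (l : ℕ) :
    (data r I.encode l).Located (I.helpful r) (I.lastFar r) I.m := by
  classical
  have hB : (data r I.encode l).B = I.T.length + 1 := rfl
  refine ⟨fun j hj => ?_, ?_, fun j hj a ha => ?_, fun j _ => I.lastFar_lt r j, fun j q => ?_,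
    fun j hj q hq => ?_, fun S hS => ?_⟩
  · have := ((I.mem_helpful r).1 hj).1
    omega
  · have := I.card_le_of_subset_helpful r subset_rfl
    omega
  · have hj' : j < I.T.length := by omega
    rw [mem_helpful, lastFar_eq_iff r I ha, and_iff_right hj']
    rfl
  · simp only [data]
    split_ifs <;> omega
  · have hfar : Far r I.encode j q := by
      simpa [data] using hq
    obtain ⟨hqm, -⟩ := (I.addApproves_iff r j ((I.mem_helpful r).1 hj).1 _).1 hfar.1
    exact ⟨((I.lastFar_eq_iff r (I.lastFar_lt r j)).1 rfl).1 q hqm hfar,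
      I.lastFar_lt_add r hj hfar⟩
  · rw [sum_xt]
    exact digitSum_lt fun i => window_lt (I.sum_near_lt r hS) _ i

theorem isYes_iff_feas : I.IsYes r ↔ ∃ l < I.R + 1,
    (data r I.encode l).Feas (I.m * (I.T.length + 1)) 0 0 := by
  rw [isYes_iff]
  refine exists_congr fun l => and_congr_right fun _ => ?_
  have := (I.located r l).feas_iff
  rw [show (data r I.encode l).B = I.T.length + 1 from rfl] at this
  rw [this]
  refine exists_congr fun S => and_congr_right fun hS => ?_
  rw [I.fin_and_chk_iff r l hS, I.forall_admissible_iff r l hS]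

end AVInstance

theorem theorem1 (r : ℕ) :
    RAM.PolyTimeSolvable (AVInstance.encode (k := 2)) (AVInstance.IsYes (k := 2) r) :=
  AVInput.polyTimeSolvable_of_feas (r := r) AVInstance.le_inputLength AVInstance.R_le
    (AVInstance.isYes_iff_feas r)
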